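/- \textbf{Setting.} Let $s=(s_m)_{m\ge 0}$ be a scale: $s_0=1$, and $s_1<s_2<\cdots$ are positive integers with $s_m\mid s_{m+1}$. Let $S=\operatorname{lcm}(s_m)$ and let $\mathbb Z_S=\varprojlim \mathbb Z/s_m\mathbb Z$ be the odometer, with its normalized Haar measure $dx$; non-negative integers are regarded as elements of $\mathbb Z_S$. Its dual group is $\widetilde{\mathbb Z_S}=\{z\in S^1: z^{s_m}=1\text{ for some }m\}$, with characters $\chi_z$, $\chi_z(1)=z$. Let $l=(l_m)_{m\ge0}$ be an increasing (not necessarily strictly) real sequence with $l_0=1$, $l_m>1$ for $m\ge1$, and $l_m\to\infty$. The length function $\lambda=\lambda_{s,l}$ is $\lambda(z)=l_m$, where $m\geq 0$ is least with $z^{s_m}=1$. For $f\in C(\mathbb Z_S)$ put $\hat f_z=\int f\,\overline{\chi_z}\,dx$, $\|f\|_N=\sum_z|\hat f_z|\lambda(z)^N$, and let $C_{RD}(\mathbb Z_S)=\{f\in C(\mathbb Z_S):\|f\|_N<\infty\text{ for all }N\ge 0\}$. For an integer $y\ge1$ let $n(y)$ be the index with $s_{n(y)-1}\le y<s_{n(y)}$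 and $\gamma(y)=y \bmod s_{n(y)-1}$; put $n(0)=0$, so that $\Lambda(y):=l_{n(y)}$ satisfies $\Lambda(0)=1$. Let $1_{(y)}\in C(\mathbb Z_S,\mathbb Z)$ be the characteristic function of $\{x\in\mathbb Z_S: s_{n(y)}\mid x-y\}$. Let $\Phi\in\operatorname{Hom}(C(\mathbb Z_S,\mathbb Z),\mathbb Z)$ and $\phi_{(y)}=\Phi(1_{(y)})$. Let $H_{odd}$ and $H_{ev}$ be Hilbert spaces with orthonormal bases $E^{odd,\pm}_{(y,j)}$ and $E^{ev,\pm}_{(y,j)}$ respectively, where $y\ge0$, $1\le j\le|\phi_{(y)}|$, and the sign is that of $\phi_{(y)}$. Define diagonal $*$-representations of $C(\mathbb Z_S)$ (not necessarily unital) by $$\rho_{odd}(f)E^{odd,+}_{(y,j)}=f(y)E^{odd,+}_{(y,j)},\quad \rho_{odd}(f)E^{odd,-}_{(y,j)}=f(\gamma(y))E^{odd,-}_{(y,j)},$$ $$\rho_{ev}(f)E^{ev,+}_{(y,j)}=f(\gamma(y))E^{ev,+}_{(y,j)},\quad \rho_{ev}(f)E^{ev,-}_{(y,j)}=f(y)E^{ev,-}_{(y,j)},$$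 where $f(\gamma(0))$ is read as $0$. Let $D$ be the operator from $H_{odd}$ to $H_{ev}$ with $DE^{odd,\pm}_{(y,j)}=\Lambda(y)E^{ev,\pm}_{(y,j)}$ on its maximal domain, $\rho=\rho_{ev}\oplus\rho_{odd}$, and $\mathcal D=\begin{bmatrix}0&D\\D^*&0\end{bmatrix}$ on $H_{ev}\oplus H_{odd}$. \textbf{Theorem.} $(C_{RD}(\mathbb Z_S),\rho,\mathcal D)$ is an even spectral triple for $C(\mathbb Z_S)$: $C_{RD}(\mathbb Z_S)$ is a dense $*$-subalgebra, $\mathcal D$ is self-adjoint, $\rho(f)$ preserves $\operatorname{dom}\mathcal D$ and $[\mathcal D,\rho(f)]$ is bounded for every $f\in C_{RD}(\mathbb Z_S)$, and $(1+\mathcal D^2)^{-1/2}$ is compact. More precisely, $\|[\mathcal D,\rho(f)]\|\le 2\|f\|_1$ for every $f\in C_{RD}(\mathbb Z_S)$. Moreover, for every $n$ and every projection $P\in M_n(C(\mathbb Z_S))$, the operator $\rho_{ev}(P)D\rho_{odd}(P):\operatorname{Ran}\rho_{odd}(P)\to\operatorname{Ran}\rho_{ev}(P)$ (with $\rho$ and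 $D$ extended to $n$-fold direct sums) is Fredholm; there is a unique homomorphism $K_0(C(\mathbb Z_S))\to\mathbb Z$ sending each $[P]$ to the index of this operator; and it is $\Phi$ under the identification of $K_0(C(\mathbb Z_S))$ with $C(\mathbb Z_S,\mathbb Z)$ given by $[P]\mapsto(x\mapsto\operatorname{rank}P(x))$. -/

import Mathlib

open scoped Matrix ComplexConjugate

noncomputable section

namespace OdometerNCG

/-! ### Even spectral triples and the index of unbounded operators -/

section SpectralTriples

variable {A E F H : Type*}
variable [NormedAddCommGroup E] [InnerProductSpace ℂ E] [CompleteSpace E]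
variable [NormedAddCommGroup F] [InnerProductSpace ℂ F] [CompleteSpace F]
variable [NormedAddCommGroup H] [InnerProductSpace ℂ H] [CompleteSpace H]

/-- The orthogonal direct sum `E ⊕ F` of two Hilbert spaces. -/
abbrev HSum (E F : Type*) : Type _ := WithLp 2 (E × F)

/-- The block diagonal operator `S ⊕ T` on `E ⊕ F`. -/
def blockDiag (S : E →L[ℂ] E) (T : F →L[ℂ] F) : HSum E F →L[ℂ] HSum E F :=
  ((WithLp.prodContinuousLinearEquiv 2 ℂ E F).symm : E × F →L[ℂ] HSum E F) ∘L
    (S.prodMap T) ∘L ((WithLp.prodContinuousLinearEquiv 2 ℂ E F) : HSum E F →L[ℂ] E × F)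

/-- The unbounded operator `[[0, D], [D*, 0]]` on `E ⊕ F`, with domain `dom D* ⊕ dom D`,
attached to an unbounded operator `D` from `F` to `E`. -/
def offDiag (D : F →ₗ.[ℂ] E) : HSum E F →ₗ.[ℂ] HSum E F where
  domain :=
    { carrier := {v | v.fst ∈ D.adjoint.domain ∧ v.snd ∈ D.domain}
      zero_mem' := ⟨D.adjoint.domain.zero_mem, D.domain.zero_mem⟩
      add_mem' := fun hv hw =>
        ⟨D.adjoint.domain.add_mem hv.1 hw.1, D.domain.add_mem hv.2 hw.2⟩
      smul_mem' := fun c _ hv =>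
        ⟨D.adjoint.domain.smul_mem c hv.1, D.domain.smul_mem c hv.2⟩ }
  toFun :=
    { toFun := fun v => WithLp.toLp 2 (D ⟨v.1.snd, v.2.2⟩, D.adjoint ⟨v.1.fst, v.2.1⟩)
      map_add' := fun v w => by
        rw [← WithLp.toLp_add, Prod.mk_add_mk, ← LinearPMap.map_add, ← LinearPMap.map_add]
        rfl
      map_smul' := fun c v => by
        rw [RingHom.id_apply, ← WithLp.toLp_smul, Prod.smul_mk, ← LinearPMap.map_smul,
          ← LinearPMap.map_smul]
        rfl }

/-- `R` is the bounded positive operator `(1 + T²)^{-1/2}`: its square is a two-sided inverse of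
`1 + T²`, where `T²` has domain `{v ∈ dom T | T v ∈ dom T}`. -/
structure IsInvSqrtOneAddSq (T : H →ₗ.[ℂ] H) (R : H →L[ℂ] H) : Prop where
  isPositive : R.IsPositive
  right_inv : ∀ w : H, ∃ (h : R (R w) ∈ T.domain) (hT : T ⟨R (R w), h⟩ ∈ T.domain),
    R (R w) + T ⟨T ⟨R (R w), h⟩, hT⟩ = w
  left_inv : ∀ (v : H) (h : v ∈ T.domain) (hT : T ⟨v, h⟩ ∈ T.domain),
    R (R (v + T ⟨T ⟨v, h⟩, hT⟩)) = v

/-- The commutator `[T, S]` of an unbounded operator `T` with a bounded operator `S` is defined on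
`dom T` and bounded there by the constant `C`. -/
def CommutatorBoundedBy (T : H →ₗ.[ℂ] H) (S : H →L[ℂ] H) (C : ℝ) : Prop :=
  ∀ (v : H) (h : v ∈ T.domain), ∃ hT : S v ∈ T.domain,
    ‖T ⟨S v, hT⟩ - S (T ⟨v, h⟩)‖ ≤ C * ‖v‖

/-- `(𝒜, ρev ⊕ ρodd, 𝒟)` with `𝒟 = [[0, D], [D*, 0]]` on `E ⊕ F` (even part `E`, odd part `F`) is
an even spectral triple for the unital C*-algebra `A`. Representations are *-homomorphisms, not
required to preserve the unit. -/
structure IsEvenSpectralTriple [CStarAlgebra A] (𝒜 : Set A)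
    (ρev : A →⋆ₙₐ[ℂ] (E →L[ℂ] E)) (ρodd : A →⋆ₙₐ[ℂ] (F →L[ℂ] F)) (D : F →ₗ.[ℂ] E) : Prop where
  isStarSubalgebra : ∃ B : StarSubalgebra ℂ A, (B : Set A) = 𝒜
  dense : Dense 𝒜
  closed : D.IsClosed
  denseDomain : Dense (D.domain : Set F)
  selfAdjoint : IsSelfAdjoint (offDiag D)
  mem_domain : ∀ a ∈ 𝒜, ∀ v ∈ (offDiag D).domain,
    blockDiag (ρev a) (ρodd a) v ∈ (offDiag D).domain
  bounded_commutator : ∀ a ∈ 𝒜, ∃ C : ℝ,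
    CommutatorBoundedBy (offDiag D) (blockDiag (ρev a) (ρodd a)) C
  compact_resolvent : ∃ R : HSum E F →L[ℂ] HSum E F,
    IsInvSqrtOneAddSq (offDiag D) R ∧ IsCompactOperator R

/-- The amplification of a representation `ρ` on `H` to matrices `P ∈ M_n(A)`, acting on `Hⁿ`. -/
def amplify [CStarAlgebra A] {n : ℕ}
    (ρ : A →⋆ₙₐ[ℂ] (H →L[ℂ] H))
    (P : Matrix (Fin n) (Fin n) A) :
    PiLp 2 (fun _ : Fin n => H) →ₗ[ℂ] PiLp 2 (fun _ : Fin n => H) where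
  toFun v := WithLp.toLp 2 fun i => ∑ j, ρ (P i j) (v j)
  map_add' v w := by
    ext i
    simp [Finset.sum_add_distrib]
  map_smul' c v := by
    ext i
    simp [Finset.smul_sum]

/-- The direct sum `D ⊕ ⋯ ⊕ D` of `n` copies of an unbounded operator. -/
def copies (D : F →ₗ.[ℂ] E) (n : ℕ) :
    PiLp 2 (fun _ : Fin n => F) →ₗ.[ℂ] PiLp 2 (fun _ : Fin n => E) where
  domain :=
    { carrier := {v | ∀ i, v i ∈ D.domain}
      zero_mem' := fun _ => D.domain.zero_mem
      add_mem' := fun hv hw i => D.domain.add_mem (hv i) (hw i)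
      smul_mem' := fun c _ hv i => D.domain.smul_mem c (hv i) }
  toFun :=
    { toFun := fun v => WithLp.toLp 2 fun i => D ⟨v.1 i, v.2 i⟩
      map_add' := fun v w => by
        ext i
        exact D.map_add ⟨v.1 i, v.2 i⟩ ⟨w.1 i, w.2 i⟩
      map_smul' := fun c v => by
        ext i
        exact D.map_smul c ⟨v.1 i, v.2 i⟩ }

/-- The compression `ρev(P) D ρodd(P)`, as an unbounded operator from `Ran ρodd(P)` to
`Ran ρev(P)` with domain `{v ∈ Ran ρodd(P) | ρodd(P) v ∈ dom D}`. -/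
def compression [CStarAlgebra A] {n : ℕ}
    (ρev : A →⋆ₙₐ[ℂ] (E →L[ℂ] E)) (ρodd : A →⋆ₙₐ[ℂ] (F →L[ℂ] F)) (D : F →ₗ.[ℂ] E)
    (P : Matrix (Fin n) (Fin n) A) :
    LinearMap.range (amplify ρodd P) →ₗ.[ℂ] LinearMap.range (amplify ρev P) where
  domain := (copies D n).domain.comap ((amplify ρodd P) ∘ₗ (LinearMap.range (amplify ρodd P)).subtype)
  toFun := (amplify ρev P).rangeRestrict ∘ₗ (copies D n).toFun ∘ₗ
    (((amplify ρodd P) ∘ₗ (LinearMap.range (amplify ρodd P)).subtype).restrict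
      (fun _ hv => hv))

variable {X Y : Type*} [NormedAddCommGroup X] [InnerProductSpace ℂ X]
  [NormedAddCommGroup Y] [InnerProductSpace ℂ Y]

/-- A closed densely defined operator is Fredholm if its kernel is finite-dimensional and its
range is closed and of finite codimension. -/
structure IsFredholmPMap (T : X →ₗ.[ℂ] Y) : Prop where
  closed : T.IsClosed
  dense : Dense (T.domain : Set X)
  finite_ker : FiniteDimensional ℂ (LinearMap.ker T.toFun)
  closed_range : IsClosed (LinearMap.range T.toFun : Set Y)
  finite_coker : FiniteDimensional ℂ (Y ⧸ LinearMap.range T.toFun)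

/-- The index `dim ker T - dim coker T`. -/
def fredholmIndex (T : X →ₗ.[ℂ] Y) : ℤ :=
  (Module.finrank ℂ (LinearMap.ker T.toFun) : ℤ) -
    Module.finrank ℂ (Y ⧸ LinearMap.range T.toFun)

end SpectralTriples

/-! ### The group `K₀` -/

section KTheory

/-- Projections in the matrix algebras `M_n(A)`, `n = 0, 1, 2, …`. -/
abbrev Projections (A : Type*) [Ring A] [StarRing A] : Type _ :=
  Σ n : ℕ, {P : Matrix (Fin n) (Fin n) A // IsStarProjection P}

/-- The relations of `K₀(A)`: `[P ⊕ Q] = [P] + [Q]`, and `[P] = [Q]` for Murray-von Neumann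
equivalent projections `P = V V*`, `Q = V* V` with a rectangular matrix `V`. -/
inductive K0Rel (A : Type*) [Ring A] [StarRing A] :
    FreeAbelianGroup (Projections A) → Prop
  | sum (P Q R : Projections A) (h : R.1 = P.1 + Q.1)
      (hR : R.2.1 = (Matrix.fromBlocks P.2.1 0 0 Q.2.1).reindex
        (finSumFinEquiv.trans (finCongr h.symm)) (finSumFinEquiv.trans (finCongr h.symm))) :
      K0Rel A (FreeAbelianGroup.of R - FreeAbelianGroup.of P - FreeAbelianGroup.of Q)
  | equiv (P Q : Projections A) (V : Matrix (Fin P.1) (Fin Q.1) A)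
      (hP : P.2.1 = V * Vᴴ) (hQ : Q.2.1 = Vᴴ * V) :
      K0Rel A (FreeAbelianGroup.of P - FreeAbelianGroup.of Q)

/-- `K₀` of a unital C*-algebra `A` : the Grothendieck group of the semigroup of Murray-von Neumann
classes of projections in matrix algebras over `A`, by generators and relations. -/
abbrev K0 (A : Type*) [Ring A] [StarRing A] : Type _ :=
  FreeAbelianGroup (Projections A) ⧸ AddSubgroup.closure {g | K0Rel A g}

/-- The class `[P] ∈ K₀(A)` of a projection `P ∈ M_n(A)`. -/
def K0.mk {A : Type*} [Ring A] [StarRing A] (P : Projections A) : K0 A :=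
  QuotientAddGroup.mk (FreeAbelianGroup.of P)

/-- `ind` is the index homomorphism of the even spectral triple with data `ρev, ρodd, D`: for every
projection `P` over `A`, the compression `ρev(P) D ρodd(P)` is a Fredholm operator, and the class
`[P]` is sent to its index. -/
def IsIndexHom {A E F : Type*} [CStarAlgebra A]
    [NormedAddCommGroup E] [InnerProductSpace ℂ E] [CompleteSpace E]
    [NormedAddCommGroup F] [InnerProductSpace ℂ F] [CompleteSpace F]
    (ρev : A →⋆ₙₐ[ℂ] (E →L[ℂ] E)) (ρodd : A →⋆ₙₐ[ℂ] (F →L[ℂ] F)) (D : F →ₗ.[ℂ] E)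
    (ind : K0 A →+ ℤ) : Prop :=
  ∀ P : Projections A, IsFredholmPMap (compression ρev ρodd D P.2.1) ∧
    ind (K0.mk P) = fredholmIndex (compression ρev ρodd D P.2.1)

variable {X : Type*} [TopologicalSpace X]

/-- The value at `x` of a matrix of continuous functions. -/
def evalMat {n m : ℕ} (P : Matrix (Fin n) (Fin m) C(X, ℂ)) (x : X) :
    Matrix (Fin n) (Fin m) ℂ := P.map fun f => f x

theorem evalMat_mul {n m k : ℕ} (P : Matrix (Fin n) (Fin m) C(X, ℂ))
    (Q : Matrix (Fin m) (Fin k) C(X, ℂ)) (x : X) :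
    evalMat (P * Q) x = evalMat P x * evalMat Q x := by
  ext i j
  simp [evalMat, Matrix.mul_apply, ContinuousMap.sum_apply]

theorem evalMat_conjTranspose {n m : ℕ} (P : Matrix (Fin n) (Fin m) C(X, ℂ)) (x : X) :
    evalMat Pᴴ x = (evalMat P x)ᴴ := by
  ext i j
  simp [evalMat]

theorem rank_eq_trace {n : ℕ} {M : Matrix (Fin n) (Fin n) ℂ} (hM : M * M = M) :
    (M.rank : ℂ) = M.trace := by
  have h : IsIdempotentElem (Matrix.toLin' M) := by
    rw [IsIdempotentElem, Module.End.mul_eq_comp, ← Matrix.toLin'_mul, hM]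
  have hp : LinearMap.IsProj (LinearMap.range (Matrix.toLin' M)) (Matrix.toLin' M) :=
    LinearMap.IsIdempotentElem.isProj_range _ h
  rw [← Matrix.trace_toLin'_eq, hp.trace]
  rfl

theorem continuous_rank {n : ℕ} {P : Matrix (Fin n) (Fin n) C(X, ℂ)} (hP : IsStarProjection P) :
    Continuous fun x => ((evalMat P x).rank : ℤ) := by
  have h1 : Continuous fun x => (((evalMat P x).rank : ℤ) : ℂ) := by
    have : (fun x => (((evalMat P x).rank : ℤ) : ℂ)) = fun x => ∑ i, P i i x := by
      funext x
      have hx : evalMat P x * evalMat P x = evalMat P x := by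
        rw [← evalMat_mul, hP.isIdempotentElem]
      rw [Int.cast_natCast, rank_eq_trace hx]
      rfl
    rw [this]
    exact continuous_finsetSum _ fun i _ => (P i i).continuous
  exact (Complex.isClosedEmbedding_intCast.isInducing.continuous_iff).2 h1

/-- The rank function `x ↦ rank P(x)` of a projection over `C(X)`. -/
def rankFn (P : Projections C(X, ℂ)) : C(X, ℤ) :=
  ⟨fun x => ((evalMat P.2.1 x).rank : ℤ), continuous_rank P.2.2⟩

open scoped ComplexOrder in
theorem K0Rel.rank_eq_zero {g : FreeAbelianGroup (Projections C(X, ℂ))}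
    (hg : K0Rel C(X, ℂ) g) : FreeAbelianGroup.lift rankFn g = 0 := by
  cases hg with
  | sum P Q R h hR =>
    ext x
    obtain ⟨p, P, hP⟩ := P
    obtain ⟨q, Q, hQ⟩ := Q
    obtain ⟨r, R, hR'⟩ := R
    dsimp only at h hR
    subst h
    have hx : ((evalMat R x).rank : ℂ) = (evalMat P x).rank + (evalMat Q x).rank := by
      have key : ∀ {n : ℕ} {P : Matrix (Fin n) (Fin n) C(X, ℂ)}, IsStarProjection P →
          ((evalMat P x).rank : ℂ) = (evalMat P x).trace := fun hP =>
        rank_eq_trace (by rw [← evalMat_mul, hP.isIdempotentElem])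
      rw [key hP, key hQ, key hR', hR]
      simp [Matrix.trace, evalMat, Fin.sum_univ_add, finSumFinEquiv_symm_apply_castAdd]
    have hx' : (evalMat R x).rank = (evalMat P x).rank + (evalMat Q x).rank := by
      exact_mod_cast hx
    simp [rankFn, hx']
  | equiv P Q V hP hQ =>
    ext x
    have h : (evalMat P.2.1 x).rank = (evalMat Q.2.1 x).rank := by
      rw [hP, hQ, evalMat_mul, evalMat_mul, evalMat_conjTranspose,
        Matrix.rank_self_mul_conjTranspose, Matrix.rank_conjTranspose_mul_self]
    simp [rankFn, h]

/-- The rank homomorphism `K₀(C(X)) → C(X, ℤ)`, `[P] ↦ (x ↦ rank P(x))`, by which `K₀(C(X))` is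
identified with `C(X, ℤ)` when `X` is compact, Hausdorff and totally disconnected. -/
def rankHom : K0 C(X, ℂ) →+ C(X, ℤ) :=
  QuotientAddGroup.lift _ (FreeAbelianGroup.lift rankFn) fun g hg => by
    have : AddSubgroup.closure {g | K0Rel C(X, ℂ) g} ≤
        (FreeAbelianGroup.lift (rankFn (X := X))).ker :=
      (AddSubgroup.closure_le _).2 fun g hg => K0Rel.rank_eq_zero hg
    exact this hg

end KTheory

/-! ### Diagonal representations on `ℓ²` -/

section Diagonal

variable {I A : Type*}

/-- The Hilbert space `ℓ²(I)`, with orthonormal basis indexed by `I`. -/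
abbrev L2 (I : Type*) : Type _ := lp (fun _ : I => ℂ) 2

theorem memlp_mul {a : I → ℂ} {C : ℝ} (ha : ∀ i, ‖a i‖ ≤ C) (v : L2 I) :
    Memℓp (fun i => a i * v i) 2 := by
  have h := (lp.memℓp v).norm.const_mul (𝕜 := ℝ) C
  refine h.mono fun i => ?_
  simpa using mul_le_mul_of_nonneg_right (ha i) (norm_nonneg (v i))

/-- The bounded diagonal operator on `ℓ²(I)` with diagonal entries `a i`. -/
def diagCLM (a : I → ℂ) (C : ℝ) (ha : ∀ i, ‖a i‖ ≤ C) : L2 I →L[ℂ] L2 I :=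
  LinearMap.mkContinuous
    { toFun := fun v => ⟨fun i => a i * v i, memlp_mul ha v⟩
      map_add' := fun v w => by
        ext i
        exact mul_add _ _ _
      map_smul' := fun c v => by
        ext i
        exact mul_left_comm _ _ _ }
    |C| fun v => by
      obtain ⟨c, hc⟩ : ∃ c : ℂ, ‖c‖ = |C| := ⟨(C : ℂ), Complex.norm_real C⟩
      rw [← hc, ← lp.norm_const_smul two_ne_zero]
      refine lp.norm_mono two_ne_zero fun i => ?_
      have h3 : ‖a i‖ ≤ ‖c‖ := hc ▸ (ha i).trans (le_abs_self C)
      change ‖a i * v i‖ ≤ ‖c * v i‖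
      rw [norm_mul, norm_mul]
      exact mul_le_mul_of_nonneg_right h3 (norm_nonneg (v i))

/-- The direct sum on `ℓ²(I)` of a family of one-dimensional (possibly zero) representations `χ i`
of a C*-algebra. -/
def diagRep [CStarAlgebra A] (χ : I → A →⋆ₙₐ[ℂ] ℂ) : A →⋆ₙₐ[ℂ] (L2 I →L[ℂ] L2 I) where
  toFun a := diagCLM (fun i => χ i a) ‖a‖ fun i => NonUnitalStarAlgHom.norm_apply_le (χ i) a
  map_smul' c a := by
    ext v i
    simp [diagCLM, mul_assoc]
  map_zero' := by
    ext v i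
    simp [diagCLM]
  map_add' a b := by
    ext v i
    change χ i (a + b) * v i = χ i a * v i + χ i b * v i
    rw [map_add, add_mul]
  map_mul' a b := by
    ext v i
    simp [diagCLM, mul_assoc]
  map_star' a := by
    rw [ContinuousLinearMap.star_eq_adjoint, ContinuousLinearMap.eq_adjoint_iff]
    intro v w
    rw [lp.inner_eq_tsum, lp.inner_eq_tsum]
    refine tsum_congr fun i => ?_
    simp [diagCLM, map_star, mul_assoc, mul_comm]

/-- The diagonal operator on `ℓ²(I)` with diagonal entries `w i`, on its maximal domain
`{v | ∑ |w i|² |v i|² < ∞}`. -/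
def diagPMap (w : I → ℝ) : L2 I →ₗ.[ℂ] L2 I where
  domain :=
    { carrier := {v | Memℓp (fun i => (w i : ℂ) * v i) 2}
      zero_mem' := by
        simpa using (zero_mem_ℓp' : Memℓp (fun _ : I => (0 : ℂ)) 2)
      add_mem' := fun {u v} hu hv => by
        have h := hu.add hv
        refine Eq.mp (congrArg (fun f => Memℓp f 2) ?_) h
        funext i
        exact (mul_add _ _ _).symm
      smul_mem' := fun c v hv => by
        have h := Memℓp.const_mul hv c
        refine Eq.mp (congrArg (fun f => Memℓp f 2) ?_) h
        funext i
        exact mul_left_comm _ _ _ }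
  toFun :=
    { toFun := fun v => ⟨fun i => (w i : ℂ) * v.1 i, v.2⟩
      map_add' := fun u v => by
        ext i
        exact mul_add _ _ _
      map_smul' := fun c v => by
        ext i
        exact mul_left_comm _ _ _ }

end Diagonal

/-! ### Odometers, their duals, and rapid decay functions -/

section Odometers

/-- A scale: positive integers `s 1 < s 2 < …`, each dividing the next, with `s 0 = 1`. -/
structure Scale where
  s : ℕ → ℕ
  zero : s 0 = 1
  pos : ∀ m, 0 < s m
  dvd : ∀ m, s m ∣ s (m + 1)
  lt : ∀ m, 1 ≤ m → s m < s (m + 1)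

/-- The values `l 0 = 1` and `1 < l 1 ≤ l 2 ≤ … → ∞` of a length function. -/
structure LengthValues where
  l : ℕ → ℝ
  zero : l 0 = 1
  one_lt : ∀ m, 1 ≤ m → 1 < l m
  mono : Monotone l
  tendsto : Filter.Tendsto l Filter.atTop Filter.atTop

/-- The inverse limit of the rings `ℤ / s m`, as a subring of their product. -/
def odometerSubring (S : Scale) : Subring (∀ m, ZMod (S.s m)) where
  carrier := {x | ∀ m, ZMod.castHom (S.dvd m) (ZMod (S.s m)) (x (m + 1)) = x m}
  mul_mem' := fun hx hy m => by
    rw [Pi.mul_apply, Pi.mul_apply, map_mul, hx m, hy m]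
  one_mem' := fun m => by
    rw [Pi.one_apply, Pi.one_apply, map_one]
  add_mem' := fun hx hy m => by
    rw [Pi.add_apply, Pi.add_apply, map_add, hx m, hy m]
  zero_mem' := fun m => by
    rw [Pi.zero_apply, Pi.zero_apply, map_zero]
  neg_mem' := fun hx m => by
    rw [Pi.neg_apply, Pi.neg_apply, map_neg, hx m]

/-- The odometer `ℤ_S`, with the topology induced by the product of the discrete spaces `ℤ / s m`.
The generator of its dense cyclic subgroup is `1`. -/
abbrev Odometer (S : Scale) : Type := odometerSubring S

instance (S : Scale) (m : ℕ) : NeZero (S.s m) := ⟨(S.pos m).ne'⟩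

instance (S : Scale) : CompactSpace (Odometer S) := by
  refine isCompact_iff_compactSpace.1 (IsClosed.isCompact ?_)
  have : ((odometerSubring S : Subring _) : Set (∀ m, ZMod (S.s m))) =
      ⋂ m, {x | ZMod.castHom (S.dvd m) (ZMod (S.s m)) (x (m + 1)) = x m} := by
    ext x
    simp [odometerSubring]
  rw [this]
  refine isClosed_iInter fun m => isClosed_eq ?_ (continuous_apply m)
  exact continuous_of_discreteTopology.comp (continuous_apply (m + 1))


/-- The normalized Haar measure of `ℤ_S`. -/
def haar (S : Scale) : MeasureTheory.Measure (Odometer S) :=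
  MeasureTheory.Measure.addHaarMeasure ⊤

/-- The dual group of `ℤ_S`, as the discrete group of all roots of unity `z` with `z ^ s = 1` for
some `s` dividing `S = lcm (s m)`, that is, with `z ^ (s m) = 1` for some `m`. -/
def dualGroup (S : Scale) : Set Circle := {z | ∃ m, z ^ S.s m = 1}

open Classical in
/-- The least `m` with `z ^ (s m) = 1`. Thus `m = 0` for `z = 1`, and otherwise it is the unique
`m ≥ 1` such that `z = exp (2πi j / s m)` with `0 < j < s m` and `s m / s (m - 1)` not
dividing `j`. -/
def level (S : Scale) (z : dualGroup S) : ℕ :=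
  Nat.find (show ∃ m, (z : Circle) ^ S.s m = 1 from z.2)

/-- The non-archimedean length function `λ_{s,l}` on the dual group. -/
def lengthFn (S : Scale) (L : LengthValues) (z : dualGroup S) : ℝ := L.l (level S z)

/-- The character `χ_z` of `ℤ_S` with `χ_z(1) = z`. -/
def char (S : Scale) (z : dualGroup S) (x : Odometer S) : ℂ :=
  ((z : Circle) : ℂ) ^ (x.1 (level S z)).val

/-- The Fourier coefficient `∫ f(x) conj(χ_z(x)) dx`. -/
def fourierCoeff (S : Scale) (f : C(Odometer S, ℂ)) (z : dualGroup S) : ℂ :=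
  ∫ x, f x * conj (char S z x) ∂haar S

/-- The norm `‖f‖_N = ∑ |f̂_z| λ(z)^N` is finite. -/
def RDNormFinite (S : Scale) (L : LengthValues) (N : ℕ) (f : C(Odometer S, ℂ)) : Prop :=
  Summable fun z : dualGroup S => ‖fourierCoeff S f z‖ * lengthFn S L z ^ N

/-- The norm `‖f‖_N = ∑ |f̂_z| λ(z)^N`. -/
def rdNorm (S : Scale) (L : LengthValues) (N : ℕ) (f : C(Odometer S, ℂ)) : ℝ :=
  ∑' z : dualGroup S, ‖fourierCoeff S f z‖ * lengthFn S L z ^ N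

/-- The rapid decay functions `C_RD(ℤ_S)`. -/
def rapidDecay (S : Scale) (L : LengthValues) : Set C(Odometer S, ℂ) :=
  {f | ∀ N, RDNormFinite S L N f}

end Odometers

/-! ### The spectral triple of a homomorphism `Φ : C(ℤ_S, ℤ) → ℤ` -/

section Triple

variable (S : Scale)

theorem Scale.exists_lt (x : ℕ) : ∃ n, x < S.s n := by
  have h : ∀ n, n < S.s (n + 1) := fun n => by
    induction n with
    | zero => exact S.pos 1
    | succ k ih => exact lt_of_le_of_lt ih (S.lt (k + 1) (by omega))
  exact ⟨x + 1, h x⟩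

/-- The number `n(x)` with `s (n(x) - 1) ≤ x < s (n(x))` for `x ≥ 1`, and `n(0) = 0`. -/
def lev (x : ℕ) : ℕ := Nat.find (S.exists_lt x)

/-- `γ(x) = x mod s (n(x) - 1)`, used for `x ≥ 1` only. -/
def gam (x : ℕ) : ℕ := x % S.s (lev S x - 1)

/-- The weights `Λ(y) = l (n(y))`; in particular `Λ(0) = 1`. -/
def weight (L : LengthValues) (y : ℕ) : ℝ := L.l (lev S y)

/-- The characteristic function `1_(n,x)` of `{z ∈ ℤ_S | s n divides z - x}`. -/
def indic (n x : ℕ) : C(Odometer S, ℤ) :=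
  ⟨fun z => if z.1 n = (x : ZMod (S.s n)) then 1 else 0,
    (continuous_of_discreteTopology
      (f := fun t : ZMod (S.s n) => if t = (x : ZMod (S.s n)) then (1 : ℤ) else 0)).comp
      ((continuous_apply n).comp continuous_subtype_val)⟩

/-- The free generator `1_(x) = 1_(n(x),x)` of `C(ℤ_S, ℤ)`. -/
def gen (x : ℕ) : C(Odometer S, ℤ) := indic S (lev S x) x

/-- The coefficient `φ_(y) = Φ(1_(y))` of `Φ = ∑ φ_(y) e_(y)`, where `e_(y)` is the dual basis of
the basis `1_(x)`. -/
def coeff (Φ : C(Odometer S, ℤ) →+ ℤ) (y : ℕ) : ℤ := Φ (gen S y)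

/-- The labels `(y, j)` of the basis vectors: `y = 0, 1, 2, …` and `j = 1, …, |φ_(y)|`. The
vectors `E^±_(y,j)` are those with `φ_(y) > 0` and `φ_(y) < 0` respectively. -/
abbrev Labels (Φ : C(Odometer S, ℤ) →+ ℤ) : Type := Σ y : ℕ, Fin (coeff S Φ y).natAbs

/-- The evaluation `δ_y : f ↦ f(y)`, `y = 0, 1, 2, …`. -/
def delta (y : ℕ) : C(Odometer S, ℂ) →⋆ₙₐ[ℂ] ℂ where
  toFun f := f (y : Odometer S)
  map_smul' _ _ := rfl
  map_zero' := rfl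
  map_add' _ _ := rfl
  map_mul' _ _ := rfl
  map_star' _ := rfl

/-- The evaluation `δ_{γ(y)} : f ↦ f(γ(y))` for `y ≥ 1`, and `0` for `y = 0`, in accordance with
`e_(y) = δ_y - δ_{γ(y)}` and `e_(0) = δ_0`. -/
def deltaGam (y : ℕ) : C(Odometer S, ℂ) →⋆ₙₐ[ℂ] ℂ :=
  if y = 0 then 0 else delta S (gam S y)

/-- The diagonal representation on `H_ev = ℓ²`: it acts on `E^{ev,+}_(y,j)` by `f(γ(y))` and on
`E^{ev,-}_(z,k)` by `f(z)`. -/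
def repEv (Φ : C(Odometer S, ℤ) →+ ℤ) :
    C(Odometer S, ℂ) →⋆ₙₐ[ℂ] (L2 (Labels S Φ) →L[ℂ] L2 (Labels S Φ)) :=
  diagRep fun i => if 0 < coeff S Φ i.1 then deltaGam S i.1 else delta S i.1

/-- The diagonal representation on `H_odd = ℓ²`: it acts on `E^{odd,+}_(y,j)` by `f(y)` and on
`E^{odd,-}_(z,k)` by `f(γ(z))`. -/
def repOdd (Φ : C(Odometer S, ℤ) →+ ℤ) :
    C(Odometer S, ℂ) →⋆ₙₐ[ℂ] (L2 (Labels S Φ) →L[ℂ] L2 (Labels S Φ)) :=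
  diagRep fun i => if 0 < coeff S Φ i.1 then delta S i.1 else deltaGam S i.1

/-- The unbounded operator `D : H_odd → H_ev`, `E^{odd,±}_(y,j) ↦ Λ(y) E^{ev,±}_(y,j)`, on its
maximal domain. -/
def opD (L : LengthValues) (Φ : C(Odometer S, ℤ) →+ ℤ) :
    L2 (Labels S Φ) →ₗ.[ℂ] L2 (Labels S Φ) :=
  diagPMap fun i => weight S L i.1

end Triple

end OdometerNCG

end

/-! Indexed by the labels `(y, j)`, the spaces `H_odd` and `H_ev` are one and the same `ℓ²`, and `D`
is diagonal with real entries `Λ(y) ≥ 1`. Hence `D` is self-adjoint with a bounded everywhere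
defined inverse, and all analytic assertions become assertions about diagonal entries. The resolvent
is compact because only finitely many labels have `Λ(y)` below a given bound.

The commutator with `ρ(f)` has entries `± Λ(y) (f(y) - f(γ(y)))`. Since `y` and `γ(y)` agree modulo
`s_m` for `m < n(y)`, a character of level below `n(y)` does not distinguish them, while for the
other characters `Λ(y) ≤ λ(z)`. Each Fourier mode thus contributes at most `2 |f̂_z| λ(z)`
(`norm_deltaGam_sub_mul_weight_le`). Rapid decay functions form an algebra because `λ` is
submultiplicative, and they are dense by Stone-Weierstrass; `mem_rapidDecay_iff` allows any rapidly
decaying expansion in characters in place of the Fourier series.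

For the index, `p = ρ_odd(P)` and `q = ρ_ev(P)` are fields of projection matrices over the labels,
with values `P(y)` and `P(γ(y))` in an order given by the sign of `φ_(y)`. By uniform continuity
they are close off a finite set `J` of labels. There `q p` is invertible from `Ran p` to `Ran q`
(`exists_partial_inverse`) and contributes no index. Over `J` the spaces are finite-dimensional, so
the index is the sum over `J` of the differences of ranks (`fredholm_compression`,
`index_compression`).

A locally constant `r` telescopes as `r = ∑ (r(y) - r(γ(y))) 1_(y)` (`eq_sum_gen`). Applying `Φ`
with `r = rank P` gives that same sum of ranks, each `y` being counted `|φ_(y)|` times with the sign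
of `φ_(y)`. Uniqueness holds because the classes `[P]` generate `K₀`. -/

open scoped Matrix ComplexConjugate

noncomputable section

namespace OdometerNCG

/-! ### Self-adjointness of diagonal operators -/

section SelfAdjoint

variable {E F H : Type*}
variable [NormedAddCommGroup E] [InnerProductSpace ℂ E] [CompleteSpace E]
variable [NormedAddCommGroup F] [InnerProductSpace ℂ F] [CompleteSpace F]
variable [NormedAddCommGroup H] [InnerProductSpace ℂ H] [CompleteSpace H]

/-- A densely defined, symmetric and surjective operator is self-adjoint. -/
theorem isSelfAdjoint_of_surjective {T : H →ₗ.[ℂ] H} (hd : Dense (T.domain : Set H))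
    (hsymm : T.IsFormalAdjoint T) (hsurj : ∀ w, ∃ v : T.domain, T v = w) : IsSelfAdjoint T := by
  rw [LinearPMap.isSelfAdjoint_def]
  refine le_antisymm ?_ (hsymm.le_adjoint hd)
  -- Choose `u` with `T u = T* v`. By symmetry `u - v` is orthogonal to the range of `T`, which is
  -- the whole space, so `u = v`.
  have key : ∀ v : T.adjoint.domain, ∃ u : T.domain, T u = T.adjoint v ∧ (u : H) = v := by
    intro v
    obtain ⟨u, hu⟩ := hsurj (T.adjoint v)
    refine ⟨u, hu, ?_⟩
    rw [← sub_eq_zero, ← inner_self_eq_zero (𝕜 := ℂ)]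
    obtain ⟨x, hx⟩ := hsurj ((u : H) - v)
    nth_rewrite 2 [← hx]
    rw [inner_sub_left, ← hsymm u x, hu, LinearPMap.adjoint_isFormalAdjoint hd v x, sub_self]
  refine ⟨fun v hv => ?_, fun v w hvw => ?_⟩
  · obtain ⟨u, -, hu⟩ := key ⟨v, hv⟩
    rw [← show (u : H) = v from hu]
    exact u.2
  · obtain ⟨u, hu, hu'⟩ := key v
    rw [← hu]
    exact congrArg T (Subtype.ext (hu'.trans hvw))

/-- With both summands modelled on the same space and `D = D*`, the adjoint disappears from `offDiag
D`, which becomes `[[0, D], [D, 0]]`. -/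
theorem _root_.IsSelfAdjoint.mem_offDiag_domain {D : H →ₗ.[ℂ] H} (hD : IsSelfAdjoint D)
    {v : HSum H H} : v ∈ (offDiag D).domain ↔ v.fst ∈ D.domain ∧ v.snd ∈ D.domain := by
  change v.fst ∈ D.adjoint.domain ∧ v.snd ∈ D.domain ↔ _
  rw [LinearPMap.isSelfAdjoint_def.1 hD]

theorem _root_.IsSelfAdjoint.offDiag_apply {D : H →ₗ.[ℂ] H} (hD : IsSelfAdjoint D) {v : HSum H H}
    (h : v ∈ (offDiag D).domain) (h1 : v.fst ∈ D.domain) (h2 : v.snd ∈ D.domain) :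
    offDiag D ⟨v, h⟩ = WithLp.toLp 2 (D ⟨v.snd, h2⟩, D ⟨v.fst, h1⟩) := by
  change WithLp.toLp 2 (D ⟨v.snd, h2⟩, D.adjoint ⟨v.fst, _⟩) = _
  have h : D.adjoint ≤ D := (LinearPMap.isSelfAdjoint_def.1 hD).le
  rw [@h.2 ⟨v.fst, _⟩ ⟨v.fst, h1⟩ rfl]

theorem isSelfAdjoint_offDiag {D : H →ₗ.[ℂ] H} (hD : IsSelfAdjoint D)
    (hsurj : ∀ w, ∃ v : D.domain, D v = w) : IsSelfAdjoint (offDiag D) := by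
  have hd := hD.dense_domain
  have hsymm : D.IsFormalAdjoint D := by
    have := LinearPMap.adjoint_isFormalAdjoint hd
    rwa [LinearPMap.isSelfAdjoint_def.1 hD] at this
  refine isSelfAdjoint_of_surjective ?_ ?_ ?_
  · have := (hd.prod hd).preimage (WithLp.prodContinuousLinearEquiv 2 ℂ H H).toHomeomorph.isOpenMap
    convert! this using 1
    ext v
    exact hD.mem_offDiag_domain
  · rintro ⟨v, hv⟩ ⟨w, hw⟩
    have hv' := hD.mem_offDiag_domain.1 hv
    have hw' := hD.mem_offDiag_domain.1 hw
    rw [hD.offDiag_apply hv hv'.1 hv'.2, hD.offDiag_apply hw hw'.1 hw'.2,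
      WithLp.prod_inner_apply, WithLp.prod_inner_apply, add_comm]
    exact congrArg₂ (· + ·) (hsymm ⟨v.fst, hv'.1⟩ ⟨w.snd, hw'.2⟩)
      (hsymm ⟨v.snd, hv'.2⟩ ⟨w.fst, hw'.1⟩)
  · intro w
    obtain ⟨a, ha⟩ := hsurj w.fst
    obtain ⟨b, hb⟩ := hsurj w.snd
    refine ⟨⟨WithLp.toLp 2 (b, a), hD.mem_offDiag_domain.2 ⟨b.2, a.2⟩⟩, ?_⟩
    rw [hD.offDiag_apply (v := WithLp.toLp 2 ((b : H), (a : H))) _ b.2 a.2]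
    apply WithLp.ofLp_injective
    exact Prod.ext ha hb

theorem _root_.IsSelfAdjoint.offDiag_toLp {D : H →ₗ.[ℂ] H} (hD : IsSelfAdjoint D) {x y : H}
    (h : WithLp.toLp 2 (x, y) ∈ (offDiag D).domain) (hx : x ∈ D.domain) (hy : y ∈ D.domain) :
    offDiag D ⟨WithLp.toLp 2 (x, y), h⟩ = WithLp.toLp 2 (D ⟨y, hy⟩, D ⟨x, hx⟩) :=
  hD.offDiag_apply h hx hy

theorem _root_.IsSelfAdjoint.toLp_mem_offDiag_domain {D : H →ₗ.[ℂ] H} (hD : IsSelfAdjoint D)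
    {x y : H} : WithLp.toLp 2 (x, y) ∈ (offDiag D).domain ↔ x ∈ D.domain ∧ y ∈ D.domain :=
  hD.mem_offDiag_domain

omit [CompleteSpace E] [CompleteSpace F] in
theorem blockDiag_toLp (S : E →L[ℂ] E) (T : F →L[ℂ] F) (x : E) (y : F) :
    blockDiag S T (WithLp.toLp 2 (x, y)) = WithLp.toLp 2 (S x, T y) := rfl

/-- The commutator is off-diagonal with entries `D T - S D` and `D S - T D`. Its norm is the larger
of the two, so the constant `C` is not doubled. -/
theorem commutatorBoundedBy_offDiag {D : H →ₗ.[ℂ] H} (hD : IsSelfAdjoint D) {S T : H →L[ℂ] H}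
    {C : ℝ} (hC : 0 ≤ C)
    (h1 : ∀ (v : H) (h : v ∈ D.domain), ∃ hT : T v ∈ D.domain,
      ‖D ⟨T v, hT⟩ - S (D ⟨v, h⟩)‖ ≤ C * ‖v‖)
    (h2 : ∀ (v : H) (h : v ∈ D.domain), ∃ hS : S v ∈ D.domain,
      ‖D ⟨S v, hS⟩ - T (D ⟨v, h⟩)‖ ≤ C * ‖v‖) :
    CommutatorBoundedBy (offDiag D) (blockDiag S T) C := by
  rintro ⟨x, y⟩ hv
  obtain ⟨hf, hs⟩ := hD.toLp_mem_offDiag_domain.1 hv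
  obtain ⟨hT, hTle⟩ := h1 _ hs
  obtain ⟨hS, hSle⟩ := h2 _ hf
  refine ⟨hD.mem_offDiag_domain.2 ⟨hS, hT⟩, ?_⟩
  simp only [blockDiag_toLp]
  rw [hD.offDiag_toLp _ hS hT, hD.offDiag_toLp _ hf hs, blockDiag_toLp, ← WithLp.toLp_sub,
    WithLp.prod_norm_eq_of_L2, WithLp.prod_norm_eq_of_L2]
  nth_rewrite 1 [← Real.sqrt_sq hC]
  rw [← Real.sqrt_mul (sq_nonneg _), mul_add, ← mul_pow, ← mul_pow, add_comm]
  gcongr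
  · exact hSle
  · exact hTle

omit [CompleteSpace E] [CompleteSpace F] in
theorem isPositive_blockDiag {S : E →L[ℂ] E} {T : F →L[ℂ] F}
    (hS : S.IsPositive) (hT : T.IsPositive) : (blockDiag S T).IsPositive := by
  constructor
  · intro v w
    change inner ℂ (blockDiag S T v) w = inner ℂ v (blockDiag S T w)
    rw [WithLp.prod_inner_apply, WithLp.prod_inner_apply]
    exact congrArg₂ (· + ·) (hS.1 v.fst w.fst) (hT.1 v.snd w.snd)
  · intro v
    change 0 ≤ RCLike.re (inner ℂ (blockDiag S T v) v)
    rw [WithLp.prod_inner_apply, map_add]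
    exact add_nonneg (hS.2 v.fst) (hT.2 v.snd)

/-- For `D = D*` the square of `offDiag D` is `D² ⊕ D²`, so the inverse square root is found on each
summand separately. -/
theorem IsInvSqrtOneAddSq.offDiag {D : H →ₗ.[ℂ] H} (hD : IsSelfAdjoint D) {R : H →L[ℂ] H}
    (hR : IsInvSqrtOneAddSq D R) : IsInvSqrtOneAddSq (offDiag D) (blockDiag R R) := by
  refine ⟨isPositive_blockDiag hR.isPositive hR.isPositive, ?_, ?_⟩
  · rintro ⟨x, y⟩
    obtain ⟨h1, h1', e1⟩ := hR.right_inv x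
    obtain ⟨h2, h2', e2⟩ := hR.right_inv y
    simp only [blockDiag_toLp]
    refine ⟨hD.mem_offDiag_domain.2 ⟨h1, h2⟩, ?_, ?_⟩
    · rw [hD.offDiag_toLp _ h1 h2]
      exact hD.mem_offDiag_domain.2 ⟨h2', h1'⟩
    · simp only [hD.offDiag_toLp _ h1 h2]
      rw [hD.offDiag_toLp _ h2' h1', ← WithLp.toLp_add, Prod.mk_add_mk, e1, e2]
  · rintro ⟨x, y⟩ h hT
    obtain ⟨h1, h2⟩ := hD.toLp_mem_offDiag_domain.1 h
    have hT' := hT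
    rw [hD.offDiag_toLp h h1 h2] at hT'
    obtain ⟨h2', h1'⟩ := hD.toLp_mem_offDiag_domain.1 hT'
    simp only [hD.offDiag_toLp h h1 h2]
    rw [hD.offDiag_toLp _ h2' h1', ← WithLp.toLp_add, Prod.mk_add_mk, blockDiag_toLp,
      blockDiag_toLp]
    exact congrArg (WithLp.toLp 2) (Prod.ext (hR.left_inv _ h1 h1') (hR.left_inv _ h2 h2'))

end SelfAdjoint

/-! ### Diagonal operators on `ℓ²`: self-adjointness and commutators -/

section Diag

variable {I : Type*}

theorem diagCLM_apply (a : I → ℂ) (C : ℝ) (ha : ∀ i, ‖a i‖ ≤ C) (v : L2 I) (i : I) :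
    diagCLM a C ha v i = a i * v i := rfl

theorem norm_diagCLM_le (a : I → ℂ) (C : ℝ) (ha : ∀ i, ‖a i‖ ≤ C) : ‖diagCLM a C ha‖ ≤ |C| :=
  LinearMap.mkContinuous_norm_le _ (abs_nonneg C) _

theorem mem_diagPMap_domain {w : I → ℝ} {v : L2 I} :
    v ∈ (diagPMap w).domain ↔ Memℓp (fun i => (w i : ℂ) * v i) 2 := Iff.rfl

theorem diagPMap_apply {w : I → ℝ} (v : (diagPMap w).domain) (i : I) :
    diagPMap w v i = w i * v.1 i := rfl

/-- The inverse of a diagonal operator with entries at least `1`. -/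
def diagInv (w : I → ℝ) (hw : ∀ i, 1 ≤ w i) : L2 I →L[ℂ] L2 I :=
  diagCLM (fun i => ((w i)⁻¹ : ℝ)) 1 fun i => by
    rw [Complex.norm_real, Real.norm_of_nonneg (inv_nonneg.2 (zero_le_one.trans (hw i)))]
    exact inv_le_one_of_one_le₀ (hw i)

theorem diagInv_apply (w : I → ℝ) (hw : ∀ i, 1 ≤ w i) (v : L2 I) (i : I) :
    diagInv w hw v i = ((w i)⁻¹ : ℝ) * v i := rfl

theorem diagInv_mem_domain {w : I → ℝ} (hw : ∀ i, 1 ≤ w i) (v : L2 I) :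
    diagInv w hw v ∈ (diagPMap w).domain := by
  rw [mem_diagPMap_domain]
  convert! lp.memℓp v using 2 with i
  have : (w i : ℂ) ≠ 0 := by exact_mod_cast (zero_lt_one.trans_le (hw i)).ne'
  rw [diagInv_apply, Complex.ofReal_inv, mul_inv_cancel_left₀ this]

theorem diagPMap_diagInv {w : I → ℝ} (hw : ∀ i, 1 ≤ w i) (v : L2 I)
    (h : diagInv w hw v ∈ (diagPMap w).domain) : diagPMap w ⟨diagInv w hw v, h⟩ = v := by
  ext i
  have : (w i : ℂ) ≠ 0 := by exact_mod_cast (zero_lt_one.trans_le (hw i)).ne'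
  rw [diagPMap_apply, diagInv_apply, Complex.ofReal_inv, mul_inv_cancel_left₀ this]

theorem diagInv_diagPMap {w : I → ℝ} (hw : ∀ i, 1 ≤ w i) (v : (diagPMap w).domain) :
    diagInv w hw (diagPMap w v) = v := by
  ext i
  have : (w i : ℂ) ≠ 0 := by exact_mod_cast (zero_lt_one.trans_le (hw i)).ne'
  rw [diagInv_apply, diagPMap_apply, Complex.ofReal_inv, inv_mul_cancel_left₀ this]

theorem dense_of_single_mem {p : Submodule ℂ (L2 I)} [DecidableEq I]
    (hp : ∀ i, ∀ a : ℂ, lp.single 2 i a ∈ p) : Dense (p : Set (L2 I)) := by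
  intro v
  refine mem_closure_of_tendsto (lp.hasSum_single ENNReal.ofNat_ne_top v)
    (Filter.Eventually.of_forall fun s => ?_)
  exact Submodule.sum_mem _ fun i _ => hp i _

theorem dense_diagPMap_domain {w : I → ℝ} (hw : ∀ i, 1 ≤ w i) :
    Dense ((diagPMap w).domain : Set (L2 I)) := by
  classical
  refine dense_of_single_mem fun i a => ?_
  have : lp.single 2 i a = diagInv w hw (lp.single 2 i (w i * a)) := by
    have hi : (w i : ℂ) ≠ 0 := by exact_mod_cast (zero_lt_one.trans_le (hw i)).ne'
    ext j
    rw [diagInv_apply]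
    by_cases h : j = i
    · subst h
      rw [lp.single_apply_self, lp.single_apply_self, Complex.ofReal_inv, inv_mul_cancel_left₀ hi]
    · rw [lp.single_apply_ne _ _ _ h, lp.single_apply_ne _ _ _ h, mul_zero]
  rw [this]
  exact diagInv_mem_domain hw _

theorem diagPMap_surjective {w : I → ℝ} (hw : ∀ i, 1 ≤ w i) (v : L2 I) :
    ∃ u : (diagPMap w).domain, diagPMap w u = v :=
  ⟨⟨_, diagInv_mem_domain hw v⟩, diagPMap_diagInv hw v _⟩

/-- Real entries give symmetry, and entries at least `1` give surjectivity through the bounded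
inverse. -/
theorem isSelfAdjoint_diagPMap {w : I → ℝ} (hw : ∀ i, 1 ≤ w i) : IsSelfAdjoint (diagPMap w) := by
  refine isSelfAdjoint_of_surjective (dense_diagPMap_domain hw) (fun u v => ?_)
    (diagPMap_surjective hw)
  rw [lp.inner_eq_tsum, lp.inner_eq_tsum]
  refine tsum_congr fun i => ?_
  simp only [diagPMap_apply, RCLike.inner_apply, map_mul, Complex.conj_ofReal]
  ring

theorem diagCLM_mem_domain {w : I → ℝ} (a : I → ℂ) (C : ℝ) (ha : ∀ i, ‖a i‖ ≤ C) {v : L2 I}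
    (hv : v ∈ (diagPMap w).domain) : diagCLM a C ha v ∈ (diagPMap w).domain := by
  have := memlp_mul ha (⟨_, hv⟩ : L2 I)
  rw [mem_diagPMap_domain]
  convert! this using 2 with i
  exact mul_left_comm _ _ _

/-- On the domain, this twisted commutator is itself diagonal, with entries `(a i - b i) * w i`. -/
theorem norm_diagPMap_diagCLM_sub_le {w : I → ℝ} (hw : ∀ i, 1 ≤ w i) {a b : I → ℂ} {A B C : ℝ}
    (ha : ∀ i, ‖a i‖ ≤ A) (hb : ∀ i, ‖b i‖ ≤ B) (hC : ∀ i, ‖a i - b i‖ * w i ≤ C) (hC0 : 0 ≤ C)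
    (v : L2 I) (h : v ∈ (diagPMap w).domain) :
    ‖diagPMap w ⟨diagCLM a A ha v, diagCLM_mem_domain a A ha h⟩ -
      diagCLM b B hb (diagPMap w ⟨v, h⟩)‖ ≤ C * ‖v‖ := by
  have hc : ∀ i, ‖(a i - b i) * w i‖ ≤ C := fun i => by
    rw [norm_mul, Complex.norm_real, Real.norm_of_nonneg (zero_le_one.trans (hw i))]
    exact hC i
  have key : diagPMap w ⟨diagCLM a A ha v, diagCLM_mem_domain a A ha h⟩ -
      diagCLM b B hb (diagPMap w ⟨v, h⟩) = diagCLM _ C hc v := by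
    ext i
    change (w i : ℂ) * (a i * v i) - b i * (w i * v i) = (a i - b i) * w i * v i
    ring
  rw [key]
  refine ((diagCLM _ C hc).le_of_opNorm_le (norm_diagCLM_le _ C hc) v).trans_eq ?_
  rw [abs_of_nonneg hC0]

/-- The commutator of `[[0, D], [D*, 0]]` with a diagonal operator, for diagonal `D`. -/
theorem commutatorBoundedBy_diag {w : I → ℝ} (hw : ∀ i, 1 ≤ w i) {a b : I → ℂ} {A B C : ℝ}
    (ha : ∀ i, ‖a i‖ ≤ A) (hb : ∀ i, ‖b i‖ ≤ B) (hC : ∀ i, ‖a i - b i‖ * w i ≤ C) (hC0 : 0 ≤ C) :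
    CommutatorBoundedBy (offDiag (diagPMap w)) (blockDiag (diagCLM a A ha) (diagCLM b B hb)) C := by
  refine commutatorBoundedBy_offDiag (isSelfAdjoint_diagPMap hw) hC0
    (fun v h => ⟨_, norm_diagPMap_diagCLM_sub_le hw hb ha (fun i => ?_) hC0 v h⟩)
    (fun v h => ⟨_, norm_diagPMap_diagCLM_sub_le hw ha hb hC hC0 v h⟩)
  rw [norm_sub_rev]
  exact hC i

theorem blockDiag_mem_domain {w : I → ℝ} (hw : ∀ i, 1 ≤ w i) {a b : I → ℂ} {A B : ℝ}
    (ha : ∀ i, ‖a i‖ ≤ A) (hb : ∀ i, ‖b i‖ ≤ B) {v : HSum (L2 I) (L2 I)}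
    (hv : v ∈ (offDiag (diagPMap w)).domain) :
    blockDiag (diagCLM a A ha) (diagCLM b B hb) v ∈ (offDiag (diagPMap w)).domain := by
  have hD := isSelfAdjoint_diagPMap hw
  obtain ⟨h1, h2⟩ := hD.mem_offDiag_domain.1 hv
  exact hD.mem_offDiag_domain.2 ⟨diagCLM_mem_domain a A ha h1, diagCLM_mem_domain b B hb h2⟩

/-! ### Compactness of the resolvent -/

/-- The vectors supported in a finite set form a finite-dimensional space. -/
theorem finiteDimensional_of_support {p : Submodule ℂ (L2 I)} (s : Finset I)
    (hp : ∀ v ∈ p, ∀ i ∉ s, v i = 0) : FiniteDimensional ℂ p := by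
  let f : p →ₗ[ℂ] (s → ℂ) :=
    { toFun := fun v i => v.1 i
      map_add' := fun _ _ => rfl
      map_smul' := fun _ _ => rfl }
  refine FiniteDimensional.of_injective f fun v w h => Subtype.ext ?_
  ext i
  by_cases hi : i ∈ s
  · exact congrFun h ⟨i, hi⟩
  · rw [hp v v.2 i hi, hp w w.2 i hi]

/-- The operator is the norm limit of its truncations to finite sets of labels, which have finite
rank. -/
theorem isCompactOperator_diagCLM {a : I → ℂ} {C : ℝ} (ha : ∀ i, ‖a i‖ ≤ C)
    (h : Filter.Tendsto a Filter.cofinite (nhds 0)) : IsCompactOperator (diagCLM a C ha) := by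
  classical
  have hs : ∀ (s : Finset I) (i : I), ‖if i ∈ s then a i else 0‖ ≤ C := fun s i => by
    split_ifs
    · exact ha i
    · rw [norm_zero]; exact (norm_nonneg _).trans (ha i)
  refine isCompactOperator_of_tendsto (l := Filter.atTop)
    (F := fun s : Finset I => diagCLM (fun i => if i ∈ s then a i else 0) C (hs s)) ?_
    (Filter.Eventually.of_forall fun s => ?_)
  · rw [Metric.tendsto_atTop]
    intro ε hε
    have hfin : {i | ¬ ‖a i‖ < ε / 2}.Finite := by
      have := h.norm
      rw [norm_zero] at this
      exact this.eventually (gt_mem_nhds (half_pos hε))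
    refine ⟨hfin.toFinset, fun s hsub => ?_⟩
    -- The truncation error is bounded by `ε / 2` with a non-strict inequality; the halving restores
    -- strictness.
    have hb : ∀ i, ‖(if i ∈ s then a i else 0) - a i‖ ≤ ε / 2 := fun i => by
      split_ifs with hi
      · rw [sub_self, norm_zero]; exact (half_pos hε).le
      · rw [zero_sub, norm_neg]
        by_contra hcon
        exact hi (hsub (hfin.mem_toFinset.2 fun hlt => hcon hlt.le))
    have heq : diagCLM (fun i => if i ∈ s then a i else 0) C (hs s) - diagCLM a C ha =
        diagCLM _ _ hb := by
      ext v i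
      exact (sub_mul _ _ _).symm
    rw [dist_eq_norm, heq]
    refine (norm_diagCLM_le _ _ hb).trans_lt ?_
    rw [abs_of_pos (half_pos hε)]
    exact half_lt_self hε
  · set T := diagCLM (fun i => if i ∈ s then a i else 0) C (hs s) with hT
    have : FiniteDimensional ℂ T.range := by
      refine finiteDimensional_of_support s ?_
      rintro _ ⟨v, rfl⟩ i hi
      simp [hT, diagCLM_apply, hi]
    have : ProperSpace T.range := FiniteDimensional.proper ℂ _
    exact (isCompactOperator_of_locallyCompactSpace_dom
      (T.codRestrict T.range fun v => ⟨v, rfl⟩)).clm_comp T.range.subtypeL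

theorem isCompactOperator_blockDiag {E F : Type*} [NormedAddCommGroup E] [InnerProductSpace ℂ E]
    [NormedAddCommGroup F] [InnerProductSpace ℂ F] {S : E →L[ℂ] E} {T : F →L[ℂ] F}
    (hS : IsCompactOperator S) (hT : IsCompactOperator T) : IsCompactOperator (blockDiag S T) := by
  have hp : IsCompactOperator (S.prodMap T) := by
    have h1 := (hS.comp_clm (ContinuousLinearMap.fst ℂ E F)).clm_comp (ContinuousLinearMap.inl ℂ E F)
    have h2 := (hT.comp_clm (ContinuousLinearMap.snd ℂ E F)).clm_comp (ContinuousLinearMap.inr ℂ E F)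
    convert! h1.add h2 using 1
    ext v <;> simp
  exact (hp.comp_clm (WithLp.prodContinuousLinearEquiv 2 ℂ E F : HSum E F →L[ℂ] E × F)).clm_comp
    ((WithLp.prodContinuousLinearEquiv 2 ℂ E F).symm : E × F →L[ℂ] HSum E F)

theorem isPositive_diagCLM {r : I → ℝ} {C : ℝ} (hr : ∀ i, 0 ≤ r i)
    (hC : ∀ i, ‖(r i : ℂ)‖ ≤ C) : (diagCLM (fun i => (r i : ℂ)) C hC).IsPositive := by
  constructor
  · intro v w
    change inner ℂ (diagCLM _ C hC v) w = inner ℂ v (diagCLM _ C hC w)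
    rw [lp.inner_eq_tsum, lp.inner_eq_tsum]
    refine tsum_congr fun i => ?_
    simp only [diagCLM_apply, RCLike.inner_apply, map_mul, Complex.conj_ofReal]
    ring
  · intro v
    change 0 ≤ RCLike.re (inner ℂ (diagCLM _ C hC v) v)
    rw [lp.inner_eq_tsum, RCLike.re_tsum _ (lp.summable_inner _ _)]
    refine tsum_nonneg fun i => ?_
    rw [diagCLM_apply, ← smul_eq_mul, inner_smul_left, Complex.conj_ofReal]
    simpa using mul_nonneg (hr i) (inner_self_nonneg (𝕜 := ℂ) (x := v i))

/-- The bounded operator `(1 + w²)^{-1/2}`. -/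
def diagInvSqrt (w : I → ℝ) : L2 I →L[ℂ] L2 I :=
  diagCLM (fun i => ((Real.sqrt (1 + w i ^ 2))⁻¹ : ℝ)) 1 fun i => by
    rw [Complex.norm_real, Real.norm_of_nonneg (by positivity)]
    refine inv_le_one_of_one_le₀ (Real.one_le_sqrt.2 ?_)
    nlinarith [sq_nonneg (w i)]

theorem diagInvSqrt_sq_apply (w : I → ℝ) (v : L2 I) (i : I) :
    diagInvSqrt w (diagInvSqrt w v) i = ((1 + w i ^ 2)⁻¹ : ℝ) * v i := by
  change (((Real.sqrt (1 + w i ^ 2))⁻¹ : ℝ) : ℂ) *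
    ((((Real.sqrt (1 + w i ^ 2))⁻¹ : ℝ) : ℂ) * v i) = _
  rw [← mul_assoc, ← Complex.ofReal_mul, ← mul_inv, Real.mul_self_sqrt (by positivity)]

/-- The multipliers `w / (1 + w²)` and `w² / (1 + w²)` are bounded by `1`, so `(1 + w²)⁻¹` maps into
the domain of the squared operator. -/
theorem diagInvSqrt_sq_mem (w : I → ℝ) (v : L2 I) :
    ∃ h : diagInvSqrt w (diagInvSqrt w v) ∈ (diagPMap w).domain,
      diagPMap w ⟨_, h⟩ ∈ (diagPMap w).domain := by
  have hpos : ∀ i, (0 : ℝ) < 1 + w i ^ 2 := fun i => by positivity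
  have h1 : ∀ i, ‖((w i * (1 + w i ^ 2)⁻¹ : ℝ) : ℂ)‖ ≤ 1 := fun i => by
    rw [Complex.norm_real, Real.norm_eq_abs, abs_mul, abs_of_pos (inv_pos.2 (hpos i)),
      ← div_eq_mul_inv, div_le_one (hpos i), ← sq_abs (w i)]
    nlinarith [sq_nonneg (|w i| - 1)]
  have h2 : ∀ i, ‖((w i * (w i * (1 + w i ^ 2)⁻¹) : ℝ) : ℂ)‖ ≤ 1 := fun i => by
    rw [Complex.norm_real, Real.norm_of_nonneg, ← mul_assoc, ← div_eq_mul_inv, div_le_one (hpos i)]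
    · nlinarith
    · have := hpos i
      rw [← mul_assoc]
      exact mul_nonneg (mul_self_nonneg _) (inv_nonneg.2 this.le)
  refine ⟨?_, ?_⟩
  · rw [mem_diagPMap_domain]
    convert! memlp_mul h1 v using 2 with i
    rw [diagInvSqrt_sq_apply, Complex.ofReal_mul, mul_assoc]
  · rw [mem_diagPMap_domain]
    convert! memlp_mul h2 v using 2 with i
    rw [diagPMap_apply, diagInvSqrt_sq_apply, Complex.ofReal_mul, Complex.ofReal_mul]
    ring

theorem diagInvSqrt_sq_add (w : I → ℝ) (v : L2 I)
    (h : diagInvSqrt w (diagInvSqrt w v) ∈ (diagPMap w).domain)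
    (h' : diagPMap w ⟨_, h⟩ ∈ (diagPMap w).domain) :
    diagInvSqrt w (diagInvSqrt w v) + diagPMap w ⟨diagPMap w ⟨_, h⟩, h'⟩ = v := by
  ext i
  have hpos : ((1 + w i ^ 2 : ℝ) : ℂ) ≠ 0 := by
    exact_mod_cast (show (0 : ℝ) < 1 + w i ^ 2 by positivity).ne'
  rw [lp.coeFn_add, Pi.add_apply, diagPMap_apply, diagPMap_apply, diagInvSqrt_sq_apply,
    Complex.ofReal_inv]
  field_simp
  push_cast
  ring

theorem diagInvSqrt_sq_of_add (w : I → ℝ) (v : L2 I) (h : v ∈ (diagPMap w).domain)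
    (h' : diagPMap w ⟨_, h⟩ ∈ (diagPMap w).domain) :
    diagInvSqrt w (diagInvSqrt w (v + diagPMap w ⟨diagPMap w ⟨_, h⟩, h'⟩)) = v := by
  ext i
  have hpos : ((1 + w i ^ 2 : ℝ) : ℂ) ≠ 0 := by
    exact_mod_cast (show (0 : ℝ) < 1 + w i ^ 2 by positivity).ne'
  rw [diagInvSqrt_sq_apply, lp.coeFn_add, Pi.add_apply, diagPMap_apply, diagPMap_apply,
    Complex.ofReal_inv]
  field_simp
  push_cast
  ring

theorem isInvSqrtOneAddSq_diag (w : I → ℝ) : IsInvSqrtOneAddSq (diagPMap w) (diagInvSqrt w) where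
  isPositive := isPositive_diagCLM (fun i => inv_nonneg.2 (Real.sqrt_nonneg _)) _
  right_inv v := by
    obtain ⟨h, h'⟩ := diagInvSqrt_sq_mem w v
    exact ⟨h, h', diagInvSqrt_sq_add w v h h'⟩
  left_inv := diagInvSqrt_sq_of_add w

theorem isCompactOperator_diagInvSqrt {w : I → ℝ}
    (h : Filter.Tendsto w Filter.cofinite Filter.atTop) : IsCompactOperator (diagInvSqrt w) := by
  refine isCompactOperator_diagCLM _ ?_
  have h2 : Filter.Tendsto (fun i => (Real.sqrt (1 + w i ^ 2))⁻¹) Filter.cofinite (nhds 0) := by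
    refine Filter.Tendsto.inv_tendsto_atTop (Filter.tendsto_atTop_mono (fun i => ?_) h)
    exact Real.le_sqrt_of_sq_le (by linarith)
  exact_mod_cast (Complex.continuous_ofReal.tendsto 0).comp h2

end Diag

/-! ### The odometer: uniform continuity and the basis `1_(y)` -/

section Odometers

variable (S : Scale)

theorem Scale.dvd_of_le {k m : ℕ} (h : k ≤ m) : S.s k ∣ S.s m :=
  Nat.le_induction dvd_rfl (fun _ _ ih => ih.trans (S.dvd _)) m h

theorem Scale.mono : Monotone S.s := fun _ m h => Nat.le_of_dvd (S.pos m) (S.dvd_of_le h)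

variable {S}

theorem Odometer.ext {x y : Odometer S} (h : ∀ m, x.1 m = y.1 m) : x = y :=
  Subtype.ext (funext h)

theorem Odometer.cast_apply {k m : ℕ} (h : k ≤ m) (x : Odometer S) :
    ZMod.cast (x.1 m) = x.1 k := by
  induction m, h using Nat.le_induction with
  | base => exact ZMod.cast_id _ _
  | succ m hm ih =>
    rw [← ih, ← x.2 m, ZMod.castHom_apply]
    exact (RingHom.congr_fun (ZMod.castHom_comp (S.dvd_of_le hm) (S.dvd m)) (x.1 (m + 1))).symm

theorem Odometer.natCast_apply (n m : ℕ) : (n : Odometer S).1 m = n := rfl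

theorem Odometer.natCast_val_apply {k m : ℕ} (h : k ≤ m) (x : Odometer S) :
    ((x.1 m).val : ZMod (S.s k)) = x.1 k := by
  rw [ZMod.natCast_val, Odometer.cast_apply h]

theorem Odometer.apply_eq_of_le {k m : ℕ} (h : k ≤ m) {x y : Odometer S} (hxy : x.1 m = y.1 m) :
    x.1 k = y.1 k := by
  rw [← Odometer.cast_apply h x, hxy, Odometer.cast_apply h]

theorem Odometer.continuous_apply (m : ℕ) : Continuous fun x : Odometer S => x.1 m :=
  (_root_.continuous_apply m).comp continuous_subtype_val

/-- Uniform continuity of continuous functions on the odometer. -/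
theorem exists_dist_lt_of_apply_eq {Y : Type*} [PseudoMetricSpace Y] (f : C(Odometer S, Y))
    {ε : ℝ} (hε : 0 < ε) :
    ∃ M, ∀ m, M ≤ m → ∀ x y : Odometer S, x.1 m = y.1 m → dist (f x) (f y) < ε := by
  -- The closed sets `{x_m = y_m}` decrease to the diagonal, which misses the compact set of pairs
  -- with `ε ≤ dist (f x) (f y)`. Hence one of them already misses it.
  have hK : IsCompact {p : Odometer S × Odometer S | ε ≤ dist (f p.1) (f p.2)} :=
    (isClosed_le continuous_const (by fun_prop)).isCompact
  obtain ⟨M, hM⟩ := hK.elim_directed_family_closed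
    (fun m => {p : Odometer S × Odometer S | p.1.1 m = p.2.1 m})
    (fun m => isClosed_eq ((Odometer.continuous_apply m).comp continuous_fst)
      ((Odometer.continuous_apply m).comp continuous_snd)) (by
      rw [Set.eq_empty_iff_forall_notMem]
      rintro ⟨x, y⟩ ⟨h1, h2⟩
      rw [Set.mem_iInter] at h2
      obtain rfl : x = y := Odometer.ext h2
      have : ε ≤ dist (f x) (f x) := h1
      rw [dist_self] at this
      exact absurd this hε.not_ge)
    (directed_of_isDirected_le fun k m h p hp => Odometer.apply_eq_of_le h hp)
  refine ⟨M, fun m hm x y hxy => ?_⟩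
  by_contra hcon
  exact (Set.eq_empty_iff_forall_notMem.1 hM (x, y))
    ⟨not_lt.1 hcon, Odometer.apply_eq_of_le hm hxy⟩

/-- Integers at distance less than `1` coincide, so uniform continuity with `ε = 1` gives local
constancy at a finite level. -/
theorem exists_eq_of_apply_eq (r : C(Odometer S, ℤ)) :
    ∃ M, ∀ m, M ≤ m → ∀ x y : Odometer S, x.1 m = y.1 m → r x = r y := by
  obtain ⟨M, hM⟩ := exists_dist_lt_of_apply_eq r one_pos
  refine ⟨M, fun m hm x y h => ?_⟩
  have := hM m hm x y h
  rw [Int.dist_eq'] at this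
  have h' : |r x - r y| < 1 := by exact_mod_cast this
  exact sub_eq_zero.1 (Int.abs_lt_one_iff.1 h')

variable (S)

theorem lt_s_lev (y : ℕ) : y < S.s (lev S y) := Nat.find_spec (S.exists_lt y)

theorem lev_le_iff {y m : ℕ} : lev S y ≤ m ↔ y < S.s m :=
  ⟨fun h => (lt_s_lev S y).trans_le (S.mono h), fun h => Nat.find_min' _ h⟩

theorem lev_eq_succ {y m : ℕ} (h1 : S.s m ≤ y) (h2 : y < S.s (m + 1)) : lev S y = m + 1 :=
  le_antisymm ((lev_le_iff S).2 h2) (Nat.succ_le_of_lt (not_le.1 fun h =>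
    absurd ((lev_le_iff S).1 h) h1.not_gt))

theorem gen_natCast (y k : ℕ) :
    gen S y k = if k ≡ y [MOD S.s (lev S y)] then 1 else 0 := by
  change (if ((k : ℕ) : ZMod (S.s (lev S y))) = (y : ZMod (S.s (lev S y))) then (1 : ℤ) else 0) = _
  simp only [ZMod.natCast_eq_natCast_iff]

theorem gen_apply_eq {m y : ℕ} (hy : y < S.s m) {x x' : Odometer S} (h : x.1 m = x'.1 m) :
    gen S y x = gen S y x' := by
  have := Odometer.apply_eq_of_le ((lev_le_iff S).2 hy) h
  change (if x.1 (lev S y) = _ then (1 : ℤ) else 0) = if x'.1 (lev S y) = _ then (1 : ℤ) else 0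
  rw [this]

/-- Telescoping of the differences `r(y) - r(γ(y))` along the residues of `k`. -/
theorem sum_sub_gam_mul_gen (r : ℕ → ℤ) (k m : ℕ) :
    ∑ y ∈ Finset.range (S.s m), (r y - if y = 0 then 0 else r (gam S y)) * gen S y k =
      r (k % S.s m) := by
  induction m with
  | zero =>
    have : lev S 0 = 0 := Nat.le_zero.1 ((lev_le_iff S).2 (S.pos 0))
    rw [S.zero, Finset.sum_range_one, gen_natCast, this, S.zero]
    simp [Nat.modEq_one, Nat.mod_one]
  | succ m ih =>
    rw [← Finset.sum_range_add_sum_Ico _ (S.mono m.le_succ), ih]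
    have hk := Nat.mod_lt k (S.pos (m + 1))
    have hmod : k % S.s (m + 1) % S.s m = k % S.s m := Nat.mod_mod_of_dvd _ (S.dvd m)
    -- For `s m ≤ y < s (m + 1)` the level is `m + 1` and `γ(y) = y mod s m`. At `k`, only the
    -- `1_(y)` with `y = k mod s (m + 1)` survives, and its coefficient replaces the value at `k mod
    -- s m` by the value at `k mod s (m + 1)`.
    have hterm : ∀ y ∈ Finset.Ico (S.s m) (S.s (m + 1)),
        (r y - if y = 0 then 0 else r (gam S y)) * gen S y k =
          if y = k % S.s (m + 1) then r y - r (k % S.s m) else 0 := by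
      intro y hy
      rw [Finset.mem_Ico] at hy
      have hlev := lev_eq_succ S hy.1 hy.2
      have h0 : y ≠ 0 := ((S.pos m).trans_le hy.1).ne'
      rw [if_neg h0, gen_natCast, hlev, gam, hlev, Nat.add_sub_cancel]
      have hiff : k ≡ y [MOD S.s (m + 1)] ↔ y = k % S.s (m + 1) := by
        rw [Nat.ModEq, Nat.mod_eq_of_lt hy.2, eq_comm]
      simp only [hiff]
      split_ifs with h
      · rw [mul_one]
        nth_rewrite 2 [h]
        rw [hmod]
      · rw [mul_zero]
    rw [Finset.sum_congr rfl hterm, Finset.sum_ite_eq']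
    split_ifs with h
    · ring
    -- No `y` of the new block survives exactly when the residue modulo `s (m + 1)` is already the
    -- residue modulo `s m`.
    · have : k % S.s (m + 1) < S.s m := by
        rw [Finset.mem_Ico] at h
        omega
      rw [← hmod, Nat.mod_eq_of_lt this, add_zero]

/-- Both sides depend only on the class of `x` modulo `s m`, so `x` may be replaced by its
representative `k < s m`, where the telescoping sum gives `r k`. -/
theorem eq_sum_gen {r : C(Odometer S, ℤ)} {m : ℕ}
    (hr : ∀ x y : Odometer S, x.1 m = y.1 m → r x = r y) :
    r = ∑ y ∈ Finset.range (S.s m),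
      (r (y : Odometer S) - if y = 0 then 0 else r (gam S y : Odometer S)) • gen S y := by
  ext x
  set k := (x.1 m).val with hk
  have hx : x.1 m = (k : Odometer S).1 m := by
    rw [Odometer.natCast_apply, hk, Odometer.natCast_val_apply le_rfl]
  have hkm : k % S.s m = k := Nat.mod_eq_of_lt (ZMod.val_lt _)
  rw [hr x k hx, ContinuousMap.sum_apply]
  have := sum_sub_gam_mul_gen S (fun y => r (y : Odometer S)) k m
  rw [hkm] at this
  rw [← this]
  refine Finset.sum_congr rfl fun y hy => ?_
  rw [ContinuousMap.smul_apply, gen_apply_eq S (Finset.mem_range.1 hy) hx, smul_eq_mul]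

/-- This is the expansion `Φ = ∑ φ_(y) (δ_y - δ_{γ(y)})`, with `δ_0` alone at `y = 0`. Local
constancy of `r` makes the sum finite. -/
theorem hom_apply_eq_sum (Φ : C(Odometer S, ℤ) →+ ℤ) {r : C(Odometer S, ℤ)} {m : ℕ}
    (hr : ∀ x y : Odometer S, x.1 m = y.1 m → r x = r y) :
    Φ r = ∑ y ∈ Finset.range (S.s m),
      (r (y : Odometer S) - if y = 0 then 0 else r (gam S y : Odometer S)) * coeff S Φ y := by
  conv_lhs => rw [eq_sum_gen S hr, map_sum]
  refine Finset.sum_congr rfl fun y _ => ?_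
  rw [map_zsmul, smul_eq_mul, coeff]

/-- `y` and `γ(y)` agree in `ℤ / s m` for `m < n(y)`. -/
theorem natCast_gam_apply {y m : ℕ} (hm : m < lev S y) :
    (gam S y : Odometer S).1 m = (y : Odometer S).1 m := by
  rw [Odometer.natCast_apply, Odometer.natCast_apply, ZMod.natCast_eq_natCast_iff]
  exact (Nat.mod_modEq y _).of_dvd (S.dvd_of_le (Nat.le_sub_one_of_lt hm))

end Odometers

/-! ### Characters -/

section Fourier

open MeasureTheory

variable {S : Scale}

theorem level_le_iff {z : dualGroup S} {m : ℕ} : level S z ≤ m ↔ (z : Circle) ^ S.s m = 1 := by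
  classical
  refine ⟨fun h => ?_, fun h => Nat.find_min' _ h⟩
  obtain ⟨c, hc⟩ := S.dvd_of_le h
  have : (z : Circle) ^ S.s (level S z) = 1 := Nat.find_spec z.2
  rw [hc, pow_mul, this, one_pow]

theorem coe_pow_eq_one {z : dualGroup S} {m : ℕ} (h : level S z ≤ m) :
    ((z : Circle) : ℂ) ^ S.s m = 1 := by
  rw [← Circle.coe_pow, level_le_iff.1 h, Circle.coe_one]

theorem char_eq {z : dualGroup S} {m : ℕ} (h : level S z ≤ m) (x : Odometer S) :
    char S z x = ((z : Circle) : ℂ) ^ (x.1 m).val := by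
  rw [char, ← Odometer.natCast_val_apply h, ZMod.val_natCast, ← pow_eq_pow_mod _
    (coe_pow_eq_one le_rfl)]

theorem char_natCast (z : dualGroup S) (n : ℕ) :
    char S z (n : Odometer S) = ((z : Circle) : ℂ) ^ n := by
  rw [char, Odometer.natCast_apply, ZMod.val_natCast, ← pow_eq_pow_mod _ (coe_pow_eq_one le_rfl)]

theorem char_eq_of_apply_eq {z : dualGroup S} {m : ℕ} (h : level S z ≤ m) {x y : Odometer S}
    (hxy : x.1 m = y.1 m) : char S z x = char S z y := by
  rw [char_eq h, char_eq h, hxy]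

theorem char_add (z : dualGroup S) (x y : Odometer S) :
    char S z (x + y) = char S z x * char S z y := by
  simp only [char]
  rw [← pow_add]
  change _ ^ (x.1 (level S z) + y.1 (level S z)).val = _
  rw [ZMod.val_add, ← pow_eq_pow_mod _ (coe_pow_eq_one le_rfl)]

theorem char_one (z : dualGroup S) : char S z 1 = ((z : Circle) : ℂ) := by
  simpa using char_natCast z 1

theorem norm_char (z : dualGroup S) (x : Odometer S) : ‖char S z x‖ = 1 := by
  rw [char, norm_pow, Circle.norm_coe, one_pow]

/-- Multiplication of the dual group. -/
def dualMul (z w : dualGroup S) : dualGroup S :=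
  ⟨z * w, max (level S z) (level S w), by
    rw [mul_pow, level_le_iff.1 (le_max_left _ _), level_le_iff.1 (le_max_right _ _), one_mul]⟩

/-- Inversion in the dual group. -/
def dualInv (z : dualGroup S) : dualGroup S :=
  ⟨(z : Circle)⁻¹, level S z, by rw [inv_pow, level_le_iff.1 le_rfl, inv_one]⟩

/-- The unit of the dual group. -/
def dualOne : dualGroup S := ⟨1, 0, one_pow _⟩

theorem level_dualMul (z w : dualGroup S) :
    level S (dualMul z w) ≤ max (level S z) (level S w) := by
  rw [level_le_iff]
  change ((z : Circle) * w) ^ _ = 1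
  rw [mul_pow, level_le_iff.1 (le_max_left _ _), level_le_iff.1 (le_max_right _ _), one_mul]

theorem level_dualInv (z : dualGroup S) : level S (dualInv z) ≤ level S z := by
  rw [level_le_iff]
  change ((z : Circle)⁻¹) ^ _ = 1
  rw [inv_pow, level_le_iff.1 le_rfl, inv_one]

theorem char_dualMul (z w : dualGroup S) (x : Odometer S) :
    char S (dualMul z w) x = char S z x * char S w x := by
  rw [char_eq (level_dualMul z w), char_eq (le_max_left (level S z) (level S w)),
    char_eq (le_max_right (level S z) (level S w)), ← mul_pow]
  rfl

theorem char_dualInv (z : dualGroup S) (x : Odometer S) :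
    char S (dualInv z) x = conj (char S z x) := by
  rw [char_eq (level_dualInv z), char, map_pow]
  congr 1
  change (((z : Circle)⁻¹ : Circle) : ℂ) = _
  rw [Circle.coe_inv_eq_conj]

theorem char_dualOne (x : Odometer S) : char S dualOne x = 1 := by
  rw [char]
  change ((1 : Circle) : ℂ) ^ _ = 1
  rw [Circle.coe_one, one_pow]

variable (S) in
/-- The character `χ_z` as a continuous function. -/
def charC (z : dualGroup S) : C(Odometer S, ℂ) :=
  ⟨char S z, (continuous_of_discreteTopology
    (f := fun t : ZMod (S.s (level S z)) => ((z : Circle) : ℂ) ^ t.val)).comp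
      (Odometer.continuous_apply _)⟩

theorem norm_charC_le (z : dualGroup S) : ‖charC S z‖ ≤ 1 :=
  (ContinuousMap.norm_le _ zero_le_one).2 fun x => (norm_char z x).le

theorem charC_dualMul (z w : dualGroup S) : charC S (dualMul z w) = charC S z * charC S w :=
  ContinuousMap.ext (char_dualMul z w)

theorem charC_dualInv (z : dualGroup S) : charC S (dualInv z) = star (charC S z) :=
  ContinuousMap.ext (char_dualInv z)

theorem charC_dualOne : charC S dualOne = 1 := ContinuousMap.ext char_dualOne

/-- If `x` and `y` differ modulo `s m`, take for `z` the standard primitive `s m`-th root of unity: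
its powers determine the class modulo `s m`. -/
theorem exists_char_ne {x y : Odometer S} (h : x ≠ y) : ∃ z : dualGroup S, char S z x ≠ char S z y := by
  obtain ⟨m, hm⟩ : ∃ m, x.1 m ≠ y.1 m := by
    by_contra! hcon
    exact h (Odometer.ext hcon)
  have hz : ∀ k : ℕ, (ZMod.toCircle (1 : ZMod (S.s m))) ^ k = ZMod.toCircle (k : ZMod (S.s m)) :=
    fun k => by rw [← AddChar.map_nsmul_eq_pow, nsmul_one]
  have h1 : (ZMod.toCircle (1 : ZMod (S.s m))) ^ S.s m = 1 := by
    rw [hz, ZMod.natCast_self, AddChar.map_zero_eq_one]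
  refine ⟨⟨ZMod.toCircle (1 : ZMod (S.s m)), m, h1⟩, fun heq => hm ?_⟩
  rw [char_eq (level_le_iff.2 h1), char_eq (level_le_iff.2 h1), ← Circle.coe_pow, ← Circle.coe_pow,
    Circle.coe_inj] at heq
  change (ZMod.toCircle (1 : ZMod (S.s m))) ^ _ = (ZMod.toCircle (1 : ZMod (S.s m))) ^ _ at heq
  rw [hz, hz, ZMod.natCast_zmod_val, ZMod.natCast_zmod_val] at heq
  exact ZMod.injective_toCircle heq

/-! ### Orthogonality and Fourier coefficients -/

instance : IsProbabilityMeasure (haar S) := by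
  refine ⟨?_⟩
  have := Measure.addHaarMeasure_self (K₀ := (⊤ : TopologicalSpace.PositiveCompacts (Odometer S)))
  rwa [TopologicalSpace.PositiveCompacts.coe_top] at this

instance : (haar S).IsAddHaarMeasure := Measure.isAddHaarMeasure_addHaarMeasure _

theorem integrable_haar (f : C(Odometer S, ℂ)) : Integrable f (haar S) :=
  f.continuous.integrable_of_hasCompactSupport (HasCompactSupport.of_compactSpace _)

open Classical in
-- Translation by `1` multiplies the integral by `z` and, by invariance of the measure, leaves it
-- unchanged. For `z ≠ 1` it therefore vanishes.
theorem integral_char (z : dualGroup S) :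
    ∫ x, char S z x ∂haar S = if (z : Circle) = 1 then 1 else 0 := by
  split_ifs with h
  · have : ∀ x, char S z x = 1 := fun x => by rw [char, h, Circle.coe_one, one_pow]
    simp [this]
  · have h1 := integral_add_left_eq_self (μ := haar S) (char S z) (1 : Odometer S)
    simp only [char_add, char_one] at h1
    rw [integral_const_mul] at h1
    have h2 : (((z : Circle) : ℂ) - 1) * ∫ x, char S z x ∂haar S = 0 := by
      rw [sub_mul, h1, one_mul, sub_self]
    refine (mul_eq_zero.1 h2).resolve_left fun h3 => h ?_
    exact Circle.coe_injective (sub_eq_zero.1 h3)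

/-- The Fourier coefficient as a bounded functional. -/
def fourierCLM (z : dualGroup S) : C(Odometer S, ℂ) →L[ℂ] ℂ :=
  LinearMap.mkContinuous
    { toFun := fun f => fourierCoeff S f z
      map_add' := fun f g => by
        simp only [fourierCoeff, ContinuousMap.add_apply, add_mul]
        exact integral_add (integrable_haar (f * star (charC S z)))
          (integrable_haar (g * star (charC S z)))
      map_smul' := fun c f => by
        simp only [fourierCoeff, ContinuousMap.smul_apply, smul_eq_mul, mul_assoc]
        exact integral_const_mul _ _ }
    1 fun f => by
      have := norm_integral_le_of_norm_le_const (μ := haar S) (C := ‖f‖)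
        (f := fun x => f x * conj (char S z x)) (Filter.Eventually.of_forall fun x => by
          rw [norm_mul, RCLike.norm_conj, norm_char, mul_one]
          exact f.norm_coe_le_norm x)
      simpa [fourierCoeff] using this

theorem fourierCLM_apply (z : dualGroup S) (f : C(Odometer S, ℂ)) :
    fourierCLM z f = fourierCoeff S f z := rfl

open Classical in
theorem fourierCLM_charC (z w : dualGroup S) :
    fourierCLM z (charC S w) = if w = z then 1 else 0 := by
  have h1 : fourierCLM z (charC S w) = ∫ x, char S (dualMul w (dualInv z)) x ∂haar S := by
    simp only [char_dualMul, char_dualInv]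
    rfl
  have h2 : ((dualMul w (dualInv z) : dualGroup S) : Circle) = 1 ↔ w = z := by
    change (w : Circle) * (z : Circle)⁻¹ = 1 ↔ w = z
    rw [mul_inv_eq_one, Subtype.ext_iff]
  rw [h1, integral_char]
  simp only [h2]

/-! ### Rapid decay functions -/

variable (L : LengthValues)

theorem LengthValues.one_le (m : ℕ) : 1 ≤ L.l m := L.zero ▸ L.mono (Nat.zero_le m)

theorem one_le_lengthFn (z : dualGroup S) : 1 ≤ lengthFn S L z := L.one_le _

/-- The length is ultrametric, and a maximum of two numbers at least `1` is at most their product.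
Submultiplicativity is what makes rapid decay stable under products. -/
theorem lengthFn_dualMul_le (z w : dualGroup S) :
    lengthFn S L (dualMul z w) ≤ lengthFn S L z * lengthFn S L w := by
  have hz := one_le_lengthFn L z
  have hw := one_le_lengthFn L w
  refine (L.mono (level_dualMul z w)).trans ?_
  rw [L.mono.map_max]
  exact max_le (le_mul_of_one_le_right (zero_le_one.trans hz) hw)
    (le_mul_of_one_le_left (zero_le_one.trans hw) hz)

theorem lengthFn_dualInv_le (z : dualGroup S) : lengthFn S L (dualInv z) ≤ lengthFn S L z :=
  L.mono (level_dualInv z)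

/-- `f = ∑ a i • χ_(z i)` with rapidly decaying coefficients; the `z i` may repeat. -/
def HasRapidExpansion (f : C(Odometer S, ℂ)) : Prop :=
  ∃ (ι : Type) (a : ι → ℂ) (z : ι → dualGroup S),
    (∀ N : ℕ, Summable fun i => ‖a i‖ * lengthFn S L (z i) ^ N) ∧
      HasSum (fun i => a i • charC S (z i)) f

variable {L}

theorem norm_smul_charC_le (c : ℂ) (z : dualGroup S) : ‖c • charC S z‖ ≤ ‖c‖ := by
  rw [norm_smul]
  exact mul_le_of_le_one_right (norm_nonneg _) (norm_charC_le z)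

theorem hasRapidExpansion_smul_charC (c : ℂ) (z : dualGroup S) :
    HasRapidExpansion L (c • charC S z) :=
  ⟨Unit, fun _ => c, fun _ => z, fun _ => Summable.of_finite, hasSum_unique _⟩

/-- Since characters may repeat in an expansion, sums are indexed by the disjoint union and products
by the product of the index types. No convolution of Fourier coefficients is needed. -/
theorem HasRapidExpansion.add {f g : C(Odometer S, ℂ)} (hf : HasRapidExpansion L f)
    (hg : HasRapidExpansion L g) : HasRapidExpansion L (f + g) := by
  obtain ⟨ι, a, z, ha, hz⟩ := hf
  obtain ⟨κ, b, w, hb, hw⟩ := hg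
  exact ⟨ι ⊕ κ, Sum.elim a b, Sum.elim z w, fun N => Summable.sum _ (ha N) (hb N), hz.sum hw⟩

theorem HasRapidExpansion.star {f : C(Odometer S, ℂ)} (hf : HasRapidExpansion L f) :
    HasRapidExpansion L (star f) := by
  obtain ⟨ι, a, z, ha, hz⟩ := hf
  refine ⟨ι, fun i => conj (a i), fun i => dualInv (z i), fun N => ?_, ?_⟩
  · refine (ha N).of_nonneg_of_le (fun i => ?_) fun i => ?_
    · have := zero_le_one.trans (one_le_lengthFn L (dualInv (z i)))
      positivity
    · rw [RCLike.norm_conj]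
      have := zero_le_one.trans (one_le_lengthFn L (dualInv (z i)))
      gcongr
      exact lengthFn_dualInv_le L _
  · convert! hz.star using 2 with i
    rw [star_smul, charC_dualInv]
    rfl

theorem HasRapidExpansion.mul {f g : C(Odometer S, ℂ)} (hf : HasRapidExpansion L f)
    (hg : HasRapidExpansion L g) : HasRapidExpansion L (f * g) := by
  obtain ⟨ι, a, z, ha, hz⟩ := hf
  obtain ⟨κ, b, w, hb, hw⟩ := hg
  have hnonneg : ∀ (c : ℂ) (u : dualGroup S) (N : ℕ), 0 ≤ ‖c‖ * lengthFn S L u ^ N := fun c u N => by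
    have := zero_le_one.trans (one_le_lengthFn L u)
    positivity
  refine ⟨ι × κ, fun p => a p.1 * b p.2, fun p => dualMul (z p.1) (w p.2), fun N => ?_, ?_⟩
  · refine ((ha N).mul_of_nonneg (hb N) (fun i => hnonneg _ _ _)
      (fun i => hnonneg _ _ _)).of_nonneg_of_le (fun p => hnonneg _ _ _) fun p => ?_
    rw [norm_mul, mul_mul_mul_comm, ← mul_pow]
    have := zero_le_one.trans (one_le_lengthFn L (dualMul (z p.1) (w p.2)))
    gcongr
    exact lengthFn_dualMul_le L _ _
  · have h1 : Summable fun i => ‖a i • charC S (z i)‖ :=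
      (ha 0).of_nonneg_of_le (fun _ => norm_nonneg _) fun i => by
        simpa using norm_smul_charC_le (a i) (z i)
    have h2 : Summable fun i => ‖b i • charC S (w i)‖ :=
      (hb 0).of_nonneg_of_le (fun _ => norm_nonneg _) fun i => by
        simpa using norm_smul_charC_le (b i) (w i)
    have h3 : Summable fun p : ι × κ => (a p.1 • charC S (z p.1)) * (b p.2 • charC S (w p.2)) :=
      Summable.of_norm_bounded (h1.mul_of_nonneg h2 (fun _ => norm_nonneg _) fun _ => norm_nonneg _)
        fun p => norm_mul_le (a p.1 • charC S (z p.1)) (b p.2 • charC S (w p.2))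
    have h4 := HasSum.mul hz hw h3
    simpa only [charC_dualMul, smul_mul_smul_comm] using h4

theorem hasRapidExpansion_algebraMap (c : ℂ) :
    HasRapidExpansion L (algebraMap ℂ C(Odometer S, ℂ) c) := by
  rw [Algebra.algebraMap_eq_smul_one, ← charC_dualOne]
  exact hasRapidExpansion_smul_charC _ _

variable (S L) in
/-- The star subalgebra of functions with a rapidly decaying expansion. -/
def rapidSubalgebra : StarSubalgebra ℂ C(Odometer S, ℂ) where
  carrier := {f | HasRapidExpansion L f}
  mul_mem' := HasRapidExpansion.mul
  add_mem' := HasRapidExpansion.add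
  algebraMap_mem' := hasRapidExpansion_algebraMap
  star_mem' := HasRapidExpansion.star

/-- Stone-Weierstrass: the subalgebra contains the characters, and these separate points. -/
theorem dense_rapidSubalgebra : Dense (rapidSubalgebra S L : Set C(Odometer S, ℂ)) := by
  have h := ContinuousMap.starSubalgebra_topologicalClosure_eq_top_of_separatesPoints
    (rapidSubalgebra S L) fun x y hxy => by
      obtain ⟨z, hz⟩ := exists_char_ne hxy
      have hmem : charC S z ∈ rapidSubalgebra S L := by
        have := hasRapidExpansion_smul_charC (L := L) 1 z
        rwa [one_smul] at this
      exact ⟨_, ⟨charC S z, hmem, rfl⟩, hz⟩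
  rw [dense_iff_closure_eq, ← StarSubalgebra.topologicalClosure_coe, h]
  rfl

/-- A function orthogonal to all characters is orthogonal to a dense subalgebra, hence to itself.
Then `∫ |h|² = 0` forces `h = 0`, as `h` is continuous and Haar measure charges every nonempty open
set. Any `L` serves, as it only selects the dense subalgebra. -/
theorem eq_zero_of_fourierCoeff_eq_zero (L : LengthValues) {h : C(Odometer S, ℂ)}
    (h0 : ∀ z, fourierCoeff S h z = 0) : h = 0 := by
  have hφ : ∀ g : C(Odometer S, ℂ), fourierCLM dualOne g = ∫ x, g x ∂haar S := fun g => by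
    rw [fourierCLM_apply]
    simp only [fourierCoeff, char_dualOne, map_one, mul_one]
  have hcont : Continuous fun g : C(Odometer S, ℂ) => fourierCLM dualOne (h * star g) := by
    fun_prop
  have hz : ∀ g : C(Odometer S, ℂ), fourierCLM dualOne (h * star g) = 0 := by
    refine fun g => congrFun (hcont.ext_on (dense_rapidSubalgebra (L := L)) continuous_const ?_) g
    rintro g ⟨ι, a, z, -, hz⟩
    have h1 := (hz.star.mul_left h).mapL (fourierCLM dualOne)
    have h2 : ∀ i, fourierCLM dualOne (h * star (a i • charC S (z i))) = 0 := fun i => by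
      rw [star_smul, mul_smul_comm, map_smul, hφ]
      have h3 : ∫ x, (h * star (charC S (z i))) x ∂haar S = 0 := h0 (z i)
      rw [h3, smul_zero]
    simp only [h2] at h1
    exact h1.unique hasSum_zero
  have h1 := hz h
  rw [hφ] at h1
  have h2 : ∫ x, ‖h x‖ ^ 2 ∂haar S = 0 := by
    have : ∀ x, (h * star h) x = ((‖h x‖ ^ 2 : ℝ) : ℂ) := fun x => by
      push_cast
      exact Complex.mul_conj' _
    simp only [this] at h1
    rw [integral_complex_ofReal] at h1
    exact_mod_cast h1
  have h3 : (fun x => ‖h x‖ ^ 2) = fun _ => (0 : ℝ) := by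
    have hc : Continuous fun x => ‖h x‖ ^ 2 := by fun_prop
    have hi := hc.integrable_of_hasCompactSupport (μ := haar S) (HasCompactSupport.of_compactSpace _)
    exact (hc.ae_eq_iff_eq (haar S) continuous_const).1
      ((integral_eq_zero_iff_of_nonneg (fun x => by positivity) hi).1 h2)
  ext x
  simpa using congrFun h3 x

/-- The series converges absolutely in the uniform norm to some `g`. By orthogonality `g` has the
same Fourier coefficients as `f`, so `g = f`. -/
theorem hasSum_fourierCoeff {f : C(Odometer S, ℂ)} (L : LengthValues)
    (hf : Summable fun z => ‖fourierCoeff S f z‖) :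
    HasSum (fun z => fourierCoeff S f z • charC S z) f := by
  classical
  have hs : Summable fun z => fourierCoeff S f z • charC S z :=
    (hf.of_nonneg_of_le (fun _ => norm_nonneg _) fun z => norm_smul_charC_le _ _).of_norm
  obtain ⟨g, hg⟩ := hs
  have : f - g = 0 := by
    refine eq_zero_of_fourierCoeff_eq_zero L fun w => ?_
    have h1 := hg.mapL (fourierCLM w)
    simp only [map_smul, fourierCLM_charC, smul_eq_mul, mul_ite, mul_one, mul_zero] at h1
    have h2 := hasSum_ite_eq w (fourierCoeff S f w)
    have h3 : fourierCLM w g = fourierCoeff S f w := by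
      refine h1.unique ?_
      convert! h2 using 2 with z
      split_ifs with h
      · rw [h]
      · rfl
    rw [← fourierCLM_apply, map_sub, h3, fourierCLM_apply, sub_self]
  exact (sub_eq_zero.1 this).symm ▸ hg

/-- Orthogonality shows that `f̂_w` is the sum of the coefficients `a i` with `z i = w`. By the
triangle inequality, collecting equal characters can only decrease the weighted sums. -/
theorem mem_rapidDecay_iff {f : C(Odometer S, ℂ)} :
    f ∈ rapidDecay S L ↔ HasRapidExpansion L f := by
  classical
  constructor
  · intro hf
    refine ⟨dualGroup S, fourierCoeff S f, id, hf, hasSum_fourierCoeff L ?_⟩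
    simpa [RDNormFinite] using hf 0
  · rintro ⟨ι, a, z, ha, hz⟩ N
    have hsum := ((Equiv.sigmaFiberEquiv z).summable_iff.2 (ha N)).sigma
    have ha0 : Summable fun i => ‖a i‖ := by simpa using ha 0
    refine hsum.of_nonneg_of_le (fun w => ?_) fun w => ?_
    · have := zero_le_one.trans (one_le_lengthFn L w)
      positivity
    · have h1 := hz.mapL (fourierCLM w)
      simp only [map_smul, fourierCLM_charC, smul_eq_mul, mul_ite, mul_one, mul_zero] at h1
      have h2 : fourierCoeff S f w = ∑' i : {i // z i = w}, a i := by
        rw [← fourierCLM_apply, ← h1.tsum_eq]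
        refine Eq.trans (tsum_congr fun i => ?_) (tsum_subtype {i | z i = w} a).symm
        rw [Set.indicator_apply]
        rfl
      have h3 : ∀ i : {i // z i = w}, ‖a i‖ * lengthFn S L w ^ N =
          ‖a i‖ * lengthFn S L (z i) ^ N := fun i => by rw [i.2]
      rw [h2]
      calc _ ≤ (∑' i : {i // z i = w}, ‖a i‖) * lengthFn S L w ^ N := by
            have := zero_le_one.trans (one_le_lengthFn L w)
            gcongr
            exact norm_tsum_le_tsum_norm (ha0.subtype _)
        _ = _ := by
          rw [← tsum_mul_right]
          exact tsum_congr h3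

theorem coe_rapidSubalgebra : (rapidSubalgebra S L : Set C(Odometer S, ℂ)) = rapidDecay S L :=
  Set.ext fun _ => mem_rapidDecay_iff.symm

theorem dense_rapidDecay : Dense (rapidDecay S L) :=
  coe_rapidSubalgebra (S := S) (L := L) ▸ dense_rapidSubalgebra

theorem hasSum_eval {f : C(Odometer S, ℂ)} (hf : f ∈ rapidDecay S L) (x : Odometer S) :
    HasSum (fun z => fourierCoeff S f z * char S z x) (f x) := by
  have h := hasSum_fourierCoeff L (f := f) (by simpa [RDNormFinite] using hf 0)
  exact h.mapL (ContinuousMap.evalCLM ℂ x)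

/-- The estimate holds for each Fourier mode. Below level `n(y)` the values of `χ_z` at `y` and
`γ(y)` cancel; from that level on, `Λ(y) ≤ λ(z)` and the two values differ by at most `2`. -/
theorem norm_deltaGam_sub_mul_weight_le {f : C(Odometer S, ℂ)} (hf : f ∈ rapidDecay S L) (y : ℕ) :
    ‖delta S y f - deltaGam S y f‖ * weight S L y ≤ 2 * rdNorm S L 1 f := by
  have hw0 : 0 ≤ weight S L y := zero_le_one.trans (L.one_le _)
  have key : ∃ b : dualGroup S → ℂ, HasSum (fun z => fourierCoeff S f z * b z)
      (delta S y f - deltaGam S y f) ∧ ∀ z, ‖b z‖ * weight S L y ≤ 2 * lengthFn S L z := by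
    by_cases hy : y = 0
    -- At `y = 0` nothing is subtracted and nothing cancels, but the weight is `Λ(0) = 1 ≤ λ(z)`.
    · subst hy
      refine ⟨fun z => char S z (0 : ℕ), ?_, fun z => ?_⟩
      · rw [deltaGam, if_pos rfl, NonUnitalStarAlgHom.zero_apply, sub_zero]
        exact hasSum_eval hf (0 : ℕ)
      · have : weight S L 0 = 1 := by
          rw [weight, Nat.le_zero.1 ((lev_le_iff S).2 (S.pos 0)), L.zero]
        rw [norm_char, this]
        linarith [one_le_lengthFn L z]
    · refine ⟨fun z => char S z (y : Odometer S) - char S z (gam S y : Odometer S), ?_, fun z => ?_⟩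
      · have := (hasSum_eval hf y).sub (hasSum_eval hf (gam S y))
        simp only [← mul_sub] at this
        rw [deltaGam, if_neg hy]
        exact this
      · rcases lt_or_ge (level S z) (lev S y) with h | h
        · dsimp only
          rw [char_eq_of_apply_eq le_rfl (natCast_gam_apply S h), sub_self, norm_zero, zero_mul]
          linarith [one_le_lengthFn L z]
        · have h1 := norm_sub_le (char S z (y : Odometer S)) (char S z (gam S y : Odometer S))
          rw [norm_char, norm_char] at h1
          have h2 : weight S L y ≤ lengthFn S L z := L.mono h
          nlinarith
  obtain ⟨b, hb, hle⟩ := key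
  have hsum : Summable fun z => ‖fourierCoeff S f z‖ * lengthFn S L z := by
    simpa [RDNormFinite] using hf 1
  have hterm : ∀ z, ‖fourierCoeff S f z * b z * weight S L y‖ ≤
      2 * (‖fourierCoeff S f z‖ * lengthFn S L z) := fun z => by
    rw [norm_mul, norm_mul, Complex.norm_real, Real.norm_of_nonneg hw0]
    nlinarith [mul_le_mul_of_nonneg_left (hle z) (norm_nonneg (fourierCoeff S f z))]
  have := tsum_of_norm_bounded (hsum.mul_left 2).hasSum hterm
  rw [(hb.mul_right _).tsum_eq, norm_mul, Complex.norm_real, Real.norm_of_nonneg hw0,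
    tsum_mul_left] at this
  simpa [rdNorm] using this

end Fourier

/-! ### An index formula for compressions -/

/-- Additivity of the index, for a composite `π ∘ T` having the same range as `π`. -/
theorem index_eq_of_comp {X Y Z : Type*} [AddCommGroup X] [Module ℂ X] [AddCommGroup Y]
    [Module ℂ Y] [AddCommGroup Z] [Module ℂ Z] (T : X →ₗ[ℂ] Y) (π : Y →ₗ[ℂ] Z)
    (h : ∀ y, ∃ x, π (T x) = π y) [FiniteDimensional ℂ (LinearMap.ker π)]
    [FiniteDimensional ℂ (LinearMap.ker (π ∘ₗ T))] :
    FiniteDimensional ℂ (LinearMap.ker T) ∧ FiniteDimensional ℂ (Y ⧸ LinearMap.range T) ∧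
    (Module.finrank ℂ (LinearMap.ker T) : ℤ) - Module.finrank ℂ (Y ⧸ LinearMap.range T) =
      Module.finrank ℂ (LinearMap.ker (π ∘ₗ T)) - Module.finrank ℂ (LinearMap.ker π) := by
  have hle : LinearMap.ker T ≤ LinearMap.ker (π ∘ₗ T) := LinearMap.ker_le_ker_comp T π
  have hker : FiniteDimensional ℂ (LinearMap.ker T) := Submodule.finiteDimensional_of_le hle
  -- The maps `t` and `s` fit into the exact sequence `0 → ker T → ker (π T) → ker π → coker T → 0`.
  -- Surjectivity of `s` is the hypothesis on ranges, and the index formula is the alternating sum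
  -- of dimensions.
  let t : LinearMap.ker (π ∘ₗ T) →ₗ[ℂ] LinearMap.ker π :=
    (T ∘ₗ (LinearMap.ker (π ∘ₗ T)).subtype).codRestrict _ fun x => x.2
  let s : LinearMap.ker π →ₗ[ℂ] Y ⧸ LinearMap.range T :=
    (LinearMap.range T).mkQ ∘ₗ (LinearMap.ker π).subtype
  have hs : Function.Surjective s := by
    intro y
    obtain ⟨y, rfl⟩ := (LinearMap.range T).mkQ_surjective y
    obtain ⟨x, hx⟩ := h y
    refine ⟨⟨y - T x, by rw [LinearMap.mem_ker, map_sub, hx, sub_self]⟩, ?_⟩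
    change (LinearMap.range T).mkQ (y - T x) = _
    rw [map_sub, sub_eq_self]
    exact (Submodule.Quotient.mk_eq_zero _).2 ⟨x, rfl⟩
  have hcoker : FiniteDimensional ℂ (Y ⧸ LinearMap.range T) := Module.Finite.of_surjective s hs
  refine ⟨hker, hcoker, ?_⟩
  have hst : LinearMap.ker s = LinearMap.range t := by
    ext ⟨y, hy⟩
    have h1 : (⟨y, hy⟩ : LinearMap.ker π) ∈ LinearMap.ker s ↔ y ∈ LinearMap.range T :=
      Submodule.Quotient.mk_eq_zero _
    rw [h1]
    constructor
    · rintro ⟨x, rfl⟩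
      exact ⟨⟨x, hy⟩, rfl⟩
    · rintro ⟨x, hx⟩
      exact ⟨x, congrArg Subtype.val hx⟩
  have hkt : Module.finrank ℂ (LinearMap.ker t) = Module.finrank ℂ (LinearMap.ker T) := by
    refine (LinearEquiv.ofBijective
      (((LinearMap.ker (π ∘ₗ T)).subtype ∘ₗ (LinearMap.ker t).subtype).codRestrict (LinearMap.ker T)
        fun x => congrArg Subtype.val x.2) ⟨fun x y hxy => ?_, fun x => ?_⟩).finrank_eq
    · have h1 : ((x : LinearMap.ker (π ∘ₗ T)) : X) = (y : LinearMap.ker (π ∘ₗ T)) :=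
        congrArg (fun u : LinearMap.ker T => (u : X)) hxy
      exact Subtype.ext (Subtype.ext h1)
    · exact ⟨⟨⟨x, hle x.2⟩, Subtype.ext x.2⟩, rfl⟩
  have e1 := t.finrank_range_add_finrank_ker
  have e2 := s.finrank_range_add_finrank_ker
  rw [hst, LinearMap.range_eq_top.2 hs, finrank_top] at e2
  rw [hkt] at e1
  omega

/-- A partial inverse of `q p` on the range of an idempotent `e` commuting with `p` and `q`. -/
theorem exists_partial_inverse {R : Type*} [Ring R] {p q e : R} (hp : p * p = p) (hq : q * q = q)
    (he : e * e = e) (hep : e * p = p * e) (heq : e * q = q * e)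
    (hu : IsUnit (1 - (2 * q - 1) * (e * (q - p)))) :
    ∃ g, g * (q * p) = e * p ∧ p * g = g ∧ q * g = e * q ∧ e * g = g ∧ g * e = g := by
  obtain ⟨z, hz⟩ := hu
  -- Equivalently `z = (1 - e) + e (q p + (1 - q) (1 - p))`. On the range of `e` this is the usual
  -- element with `z p = q p = q z`, which intertwines two nearby idempotents.
  have hz' : (z : R) = 1 - e * q - e * p + 2 * e * q * p := by
    rw [hz]
    linear_combination (norm := noncomm_ring) heq * 2 * q - heq * 2 * p - 2 * e * hq
  have hpe (x : R) : p * (e * x) = e * (p * x) := by rw [← mul_assoc, ← hep, mul_assoc]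
  have hqe (x : R) : q * (e * x) = e * (q * x) := by rw [← mul_assoc, ← heq, mul_assoc]
  have hqq (x : R) : q * (q * x) = q * x := by rw [← mul_assoc, hq]
  have hee (x : R) : e * (e * x) = e * x := by rw [← mul_assoc, he]
  have h2' (x y : R) : x * (2 * y) = 2 * (x * y) := by
    rw [← mul_assoc, (Commute.ofNat_right x 2).eq, mul_assoc]
  have hze : e * z = z * e := by
    simp only [hz', mul_add, mul_sub, add_mul, sub_mul, mul_assoc, ← hep, ← heq, hqe, h2', one_mul,
      mul_one]
  have hzp : (z : R) * (e * p) = e * (q * p) := by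
    simp only [hz', add_mul, sub_mul, mul_assoc, hpe, hqe, hee, hp, one_mul]
    noncomm_ring
  have hqz : q * (e * z) = e * (q * p) := by
    simp only [hz', mul_add, mul_sub, mul_assoc, hqe, hee, h2', hq, hqq, mul_one, ← heq]
    noncomm_ring
  have hiz (x : R) : (↑z⁻¹ : R) * (z * x) = x := Units.inv_mul_cancel_left z x
  have hie : e * (↑z⁻¹ : R) = ↑z⁻¹ * e := by
    have := congrArg (fun x => (↑z⁻¹ : R) * (x * ↑z⁻¹)) hze
    simpa only [mul_assoc, hiz, Units.mul_inv, mul_one] using this.symm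
  have hpi : p * (e * (↑z⁻¹ : R)) = ↑z⁻¹ * (q * e) := by
    have h3 : (z : R) * (e * p) = q * (e * z) := hzp.trans hqz.symm
    have := congrArg (fun x => (↑z⁻¹ : R) * (x * ↑z⁻¹)) h3
    simp only [mul_assoc, hiz, Units.mul_inv, mul_one] at this
    rw [← this, hpe]
  have hpg : p * (e * (↑z⁻¹ * q)) = e * (↑z⁻¹ * q) := by
    calc p * (e * (↑z⁻¹ * q)) = p * (e * ↑z⁻¹) * q := by simp only [mul_assoc]
      _ = ↑z⁻¹ * e * q := by rw [hpi, mul_assoc, mul_assoc, hqe, hq, mul_assoc]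
      _ = _ := by rw [← hie, mul_assoc]
  -- On the range of `e`, `z` agrees with `q p` on `Ran p` and carries it onto `Ran q`. The partial
  -- inverse is thus `z⁻¹` preceded by `q` and cut down by `e`.
  refine ⟨e * (↑z⁻¹ * q), ?_, hpg, ?_, hee _, ?_⟩
  · rw [mul_assoc, mul_assoc, hqq, ← mul_assoc e, hie, mul_assoc, ← hzp, hiz]
  · rw [← hpg, hpe, hqe]
    calc e * (q * (p * (↑z⁻¹ * q))) = e * (q * p) * (↑z⁻¹ * q) := by simp only [mul_assoc]
      _ = q * (e * (z * (↑z⁻¹ * q))) := by rw [← hqz]; simp only [mul_assoc]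
      _ = e * q := by rw [Units.mul_inv_cancel_left, hqe, hq]
  · rw [mul_assoc, mul_assoc, ← heq, ← mul_assoc _ e q, ← hie, mul_assoc, hee]

theorem finrank_eq_of_map_eq {V W : Type*} [AddCommGroup V] [Module ℂ V] [AddCommGroup W]
    [Module ℂ W] {f : V →ₗ[ℂ] W} (hf : Function.Injective f) {A : Submodule ℂ V}
    {B : Submodule ℂ W} (h : A.map f = B) [FiniteDimensional ℂ B] :
    Module.finrank ℂ A = Module.finrank ℂ B ∧ FiniteDimensional ℂ A := by
  subst h
  have φ := Submodule.equivMapOfInjective f hf A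
  exact ⟨φ.finrank_eq, Module.Finite.equiv φ.symm⟩

/-- The compression `q K⁻¹ p : Ran p → Ran q` of the inverse of an injective operator `K` is
Fredholm, if `q p : Ran p → Ran q` is invertible on the range of an idempotent `e` of finite
corank. -/
theorem fredholm_compression {W : Type*} [NormedAddCommGroup W] [InnerProductSpace ℂ W]
    {p q : W →ₗ[ℂ] W} {K D e G : W →L[ℂ] W} (hpc : Continuous p) (hqc : Continuous q)
    (hp : ∀ v, p (p v) = p v) (hq : ∀ v, q (q v) = q v) (he : ∀ v, e (e v) = e v)
    (hqe : ∀ v, q (e v) = e (q v))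
    (hK : Function.Injective K) (hKd : DenseRange K) (hKp : ∀ v, K (p v) = p (K v))
    (hKe : ∀ v, K (e v) = e (K v)) (hKD : ∀ v, K (D v) = v - e v) (hDK : ∀ v, D (K v) = v - e v)
    (hGp : ∀ v, G (q (p v)) = e (p v)) (hpG : ∀ v, p (G v) = G v) (hqG : ∀ v, q (G v) = e (q v))
    (hGe : ∀ v, G (e v) = G v) [FiniteDimensional ℂ (LinearMap.ker (e : W →ₗ[ℂ] W))]
    (T : LinearMap.range p →ₗ.[ℂ] LinearMap.range q)
    (hT : ∀ v w, (v, w) ∈ T.graph ↔ ∃ u, K u = v ∧ q u = w) :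
    IsFredholmPMap T ∧ fredholmIndex T =
      Module.finrank ℂ (LinearMap.range p ⊓ LinearMap.ker (e : W →ₗ[ℂ] W) : Submodule ℂ W) -
      Module.finrank ℂ (LinearMap.range q ⊓ LinearMap.ker (e : W →ₗ[ℂ] W) : Submodule ℂ W) := by
  have hpr : ∀ v : LinearMap.range p, p v = v := by rintro ⟨_, v, rfl⟩; exact hp v
  have hqr : ∀ v : LinearMap.range q, q v = v := by rintro ⟨_, v, rfl⟩; exact hq v
  have hpu : ∀ (v : LinearMap.range p) u, K u = v → p u = u := fun v u h =>
    hK (by rw [hKp, h, hpr])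
  have hmem : ∀ v : LinearMap.range p, v ∈ T.domain ↔ ∃ u, K u = v := by
    intro v
    constructor
    · intro hv
      obtain ⟨u, hu, -⟩ := (hT _ _).1 (T.mem_graph ⟨v, hv⟩)
      exact ⟨u, hu⟩
    · rintro ⟨u, hu⟩
      exact LinearPMap.mem_domain_of_mem_graph ((hT v ⟨q u, u, rfl⟩).2 ⟨u, hu, rfl⟩)
  have hval : ∀ v : T.domain, ∃ u, K u = v ∧ q u = T v := fun v => (hT _ _).1 (T.mem_graph v)
  have happ : ∀ (v : T.domain) u, K u = v → q u = T v := fun v u hu => by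
    obtain ⟨u', hu', h⟩ := hval v
    rw [hK (hu.trans hu'.symm), h]
  -- the restriction of `e` to the range of `q`
  let π : LinearMap.range q →ₗ[ℂ] LinearMap.range q :=
    (e : W →ₗ[ℂ] W).restrict (by rintro _ ⟨v, rfl⟩; exact ⟨e v, hqe v⟩)
  -- The plan is to apply `index_eq_of_comp` to `π` and `T`: both `ker π` and `ker (π T)` lie over
  -- `ker e`, where everything is finite-dimensional.
  have hπc : Continuous π := (e.continuous.comp continuous_subtype_val).subtype_mk _
  -- The preimage of `π w` is `K (G w)`, since `T (K (G w)) = q (G w) = e w`. So `Ran T` contains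
  -- `Ran π`.
  have hsurj : ∀ w, ∃ x, T.toFun x = π w := by
    intro w
    have hx : p (K (G w)) = K (G w) := by rw [← hKp, hpG]
    let x : LinearMap.range p := ⟨K (G w), _, hx⟩
    refine ⟨⟨x, (hmem x).2 ⟨_, rfl⟩⟩, Subtype.ext ?_⟩
    refine (happ ⟨x, (hmem x).2 ⟨_, rfl⟩⟩ (G w) rfl).symm.trans ?_
    rw [hqG, hqr]
    rfl
  have hππ : ∀ w, π (π w) = π w := fun w => Subtype.ext (he w)
  have hkerπ : Module.finrank ℂ (LinearMap.ker π) =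
      Module.finrank ℂ (LinearMap.range q ⊓ LinearMap.ker (e : W →ₗ[ℂ] W) : Submodule ℂ W) ∧
      FiniteDimensional ℂ (LinearMap.ker π) := by
    refine finrank_eq_of_map_eq (LinearMap.range q).injective_subtype ?_
    ext w
    constructor
    · rintro ⟨w, hw, rfl⟩
      exact ⟨w.2, congrArg Subtype.val hw⟩
    · rintro ⟨hw, hw'⟩
      exact ⟨⟨w, hw⟩, Subtype.ext hw', rfl⟩
  -- For `v = K u` with `π (T v) = 0` one has `e (q u) = 0`; applying `G` gives `e u = 0`, hence `e
  -- v = 0`. Conversely, `v` in `Ran p` with `e v = 0` is `K (D v)` and so lies in the domain.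
  have hkerT : Module.finrank ℂ (LinearMap.ker (π ∘ₗ T.toFun)) =
      Module.finrank ℂ (LinearMap.range p ⊓ LinearMap.ker (e : W →ₗ[ℂ] W) : Submodule ℂ W) ∧
      FiniteDimensional ℂ (LinearMap.ker (π ∘ₗ T.toFun)) := by
    refine finrank_eq_of_map_eq (f := (LinearMap.range p).subtype ∘ₗ T.domain.subtype)
      ((LinearMap.range p).injective_subtype.comp T.domain.injective_subtype) ?_
    ext v
    constructor
    · rintro ⟨v, hv, rfl⟩
      refine ⟨v.1.2, ?_⟩
      obtain ⟨u, hu, hw⟩ := hval v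
      have hv' : e (q u) = 0 := by
        rw [hw]
        exact congrArg Subtype.val hv
      have hu' : e u = 0 := by
        rw [← hpu v u hu, ← hGp, hpu v u hu, ← hGe, hv', map_zero]
      change e (v : LinearMap.range p) = 0
      rw [← hu, ← hKe, hu', map_zero]
    · rintro ⟨hv, hv'⟩
      have hv0 : e v = 0 := hv'
      have hu : K (D v) = v := by rw [hKD, hv0, sub_zero]
      refine ⟨⟨⟨v, hv⟩, (hmem _).2 ⟨_, hu⟩⟩, Subtype.ext ?_, rfl⟩
      have h4 := happ ⟨⟨v, hv⟩, (hmem _).2 ⟨_, hu⟩⟩ (D v) hu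
      change e ((T.toFun ⟨⟨v, hv⟩, _⟩ : LinearMap.range q) : W) = 0
      have h5 : e (D v) = 0 := hK (by rw [hKe, hu, hv0, map_zero])
      refine (congrArg e h4.symm).trans ?_
      rw [← hqe, h5, map_zero]
  have := hkerπ.2
  have := hkerT.2
  obtain ⟨h1, h2, h3⟩ := index_eq_of_comp T.toFun π fun w => by
    obtain ⟨x, hx⟩ := hsurj w
    exact ⟨x, by rw [hx, hππ]⟩
  refine ⟨⟨?_, ?_, h1, ?_, h2⟩, ?_⟩
  -- Splitting by `e` and `1 - e`, the relation `w = T v` becomes two equations between continuous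
  -- maps: `K (G w) = e v` and `(1 - e) w = q (D v)`. The graph is therefore closed.
  · have : (T.graph : Set (LinearMap.range p × LinearMap.range q)) =
        {x | K (G x.2) = e x.1} ∩ {x | (x.2 : W) - e x.2 = q (D x.1)} := by
      ext ⟨v, w⟩
      constructor
      · intro h
        obtain ⟨u, hu, hw⟩ := (hT v w).1 h
        have hu' := hpu v u hu
        constructor
        · change K (G w) = e v
          rw [← hw, ← hu, ← hKe, ← hu', hGp]
        · change (w : W) - e w = q (D v)
          rw [← hw, ← hu, hDK, map_sub, hqe]
      · rintro ⟨h1, h2⟩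
        change K (G w) = e v at h1
        change (w : W) - e w = q (D v) at h2
        refine (hT v w).2 ⟨G w + D v, ?_, ?_⟩
        · rw [map_add, h1, hKD, add_sub_cancel]
        · rw [map_add, ← h2, hqG, hqr, add_sub_cancel]
    rw [LinearPMap.IsClosed, this]
    exact (isClosed_eq (by fun_prop) (by fun_prop)).inter
      (isClosed_eq (by fun_prop) (hqc.comp (by fun_prop)))
  · intro v
    -- The vectors `p (K u)` are dense in `Ran p`, and they lie in the domain because `p K = K p`.
    have h4 : DenseRange fun u => (⟨p (K u), _, rfl⟩ : LinearMap.range p) := by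
      have h5 : Function.Surjective p.rangeRestrict := p.surjective_rangeRestrict
      exact h5.denseRange.comp hKd (hpc.subtype_mk _)
    refine closure_mono ?_ (h4 v)
    rintro _ ⟨u, rfl⟩
    exact (hmem _).2 ⟨p u, hKp u⟩
  -- Because `Ran π` is contained in `Ran T`, membership of `w` in `Ran T` depends only on `w - π
  -- w`. So `Ran T` is the preimage of a finite-dimensional, hence closed, subspace under a
  -- continuous map.
  · have h6 : (LinearMap.range T.toFun : Set (LinearMap.range q)) =
        (fun w => w - π w) ⁻¹' (LinearMap.range T.toFun ⊓ LinearMap.ker π : Submodule ℂ _) := by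
      ext w
      have h7 : π w ∈ LinearMap.range T.toFun := hsurj w
      constructor
      · intro hw
        refine ⟨Submodule.sub_mem _ hw h7, ?_⟩
        rw [SetLike.mem_coe, LinearMap.mem_ker, map_sub, hππ, sub_self]
      · rintro ⟨hw, -⟩
        have := Submodule.add_mem _ hw h7
        rwa [sub_add_cancel] at this
    have : FiniteDimensional ℂ (LinearMap.range T.toFun ⊓ LinearMap.ker π : Submodule ℂ _) :=
      Submodule.finiteDimensional_inf_right _ _
    rw [h6]
    exact (Submodule.closed_of_finiteDimensional _).preimage (continuous_id.sub hπc)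
  · rw [fredholmIndex, h3, hkerT.1, hkerπ.1]

/-! ### Fields of matrices acting on `ℓ²(I)ⁿ` -/

section MatrixFields

variable {I : Type*} {n : ℕ}

/-- The orthogonal direct sum of `n` copies of `ℓ²(I)`. -/
abbrev L2Pow (I : Type*) (n : ℕ) : Type _ := PiLp 2 fun _ : Fin n => L2 I

/-- The value at `i` of a vector in `ℓ²(I)ⁿ = ℓ²(I, ℂⁿ)`. -/
def fiber (i : I) : L2Pow I n →ₗ[ℂ] (Fin n → ℂ) where
  toFun v k := v k i
  map_add' _ _ := rfl
  map_smul' _ _ := rfl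

theorem ext_fiber {v w : L2Pow I n} (h : ∀ i, fiber i v = fiber i w) : v = w := by
  ext k i
  exact congrFun (h i) k

theorem norm_le_sum (v : L2Pow I n) : ‖v‖ ≤ ∑ k, ‖v k‖ := by
  have : v = ∑ k, PiLp.single 2 k (v k) := by
    ext1 k
    rw [WithLp.ofLp_sum, Finset.sum_apply]
    simp
  conv_lhs => rw [this]
  refine (norm_sum_le _ _).trans_eq ?_
  simp

/-- The operator on `ℓ²(I)ⁿ` given by a bounded field of matrices. -/
def matDiag (a : I → Matrix (Fin n) (Fin n) ℂ) (C : ℝ) (h : ∀ i j k, ‖a i j k‖ ≤ C) :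
    L2Pow I n →L[ℂ] L2Pow I n :=
  LinearMap.mkContinuous
    { toFun := fun v => WithLp.toLp 2 fun j => ∑ k, diagCLM (fun i => a i j k) C (h · j k) (v k)
      map_add' := fun v w => by
        ext1 j
        simp [Finset.sum_add_distrib]
      map_smul' := fun c v => by
        ext1 j
        simp [Finset.smul_sum] }
    -- A crude bound from summing over all matrix entries; sharpness is irrelevant, as `C` can later
    -- be taken small.
    (n * n * |C|) fun v => by
      refine (norm_le_sum _).trans ?_
      have h1 : ∀ j k : Fin n, ‖diagCLM (fun i => a i j k) C (h · j k) (v k)‖ ≤ |C| * ‖v‖ :=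
        fun j k => ((diagCLM (fun i => a i j k) C (h · j k)).le_of_opNorm_le
          (norm_diagCLM_le _ _ _) _).trans
            (mul_le_mul_of_nonneg_left (PiLp.norm_apply_le v k) (abs_nonneg C))
      have h2 : ∀ j : Fin n, ‖∑ k, diagCLM (fun i => a i j k) C (h · j k) (v k)‖ ≤
          n * (|C| * ‖v‖) := fun j =>
        (norm_sum_le _ _).trans ((Finset.sum_le_sum fun k _ => h1 j k).trans_eq (by simp))
      refine (Finset.sum_le_sum fun j _ => h2 j).trans_eq ?_
      simp
      ring

theorem norm_matDiag_le (a : I → Matrix (Fin n) (Fin n) ℂ) (C : ℝ) (h : ∀ i j k, ‖a i j k‖ ≤ C) :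
    ‖matDiag a C h‖ ≤ n * n * |C| :=
  LinearMap.mkContinuous_norm_le _ (by positivity) _

theorem fiber_matDiag (a : I → Matrix (Fin n) (Fin n) ℂ) (C : ℝ) (h : ∀ i j k, ‖a i j k‖ ≤ C)
    (v : L2Pow I n) (i : I) : fiber i (matDiag a C h v) = a i *ᵥ fiber i v := by
  ext j
  change ((∑ k, diagCLM (fun i => a i j k) C (h · j k) (v k) : L2 I) : I → ℂ) i = _
  rw [lp.coeFn_sum, Finset.sum_apply]
  rfl

theorem norm_smul_one_apply_le {c : ℂ} {C : ℝ} (h : ‖c‖ ≤ C) (j k : Fin n) :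
    ‖(c • (1 : Matrix (Fin n) (Fin n) ℂ)) j k‖ ≤ C := by
  rw [Matrix.smul_apply, Matrix.one_apply]
  split_ifs
  · simpa using h
  · simpa using (norm_nonneg c).trans h

/-- The diagonal operator with scalar entries on `ℓ²(I)ⁿ`. -/
def scalarDiag (n : ℕ) (c : I → ℂ) (C : ℝ) (h : ∀ i, ‖c i‖ ≤ C) : L2Pow I n →L[ℂ] L2Pow I n :=
  matDiag (fun i => c i • 1) C fun i => norm_smul_one_apply_le (h i)

theorem fiber_scalarDiag (c : I → ℂ) (C : ℝ) (h : ∀ i, ‖c i‖ ≤ C) (v : L2Pow I n) (i : I) :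
    fiber i (scalarDiag n c C h v) = c i • fiber i v := by
  rw [scalarDiag, fiber_matDiag, Matrix.smul_mulVec, Matrix.one_mulVec]

theorem exists_fiber_eq (J : Finset I) (x : J → Fin n → ℂ) :
    ∃ v : L2Pow I n, (∀ i : J, fiber (i : I) v = x i) ∧ ∀ i ∉ J, fiber i v = 0 := by
  classical
  let v : L2Pow I n := WithLp.toLp 2 fun k => ∑ i : J, lp.single 2 (i : I) (x i k)
  have hv : ∀ i k, fiber i v k = ∑ i' : J, if i = i' then x i' k else 0 := fun i k => by
    change ((∑ i' : J, lp.single 2 (i' : I) (x i' k) : L2 I) : I → ℂ) i = _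
    rw [lp.coeFn_sum, Finset.sum_apply]
    refine Finset.sum_congr rfl fun i' _ => ?_
    rw [lp.single_apply, Pi.single_apply]
  refine ⟨v, fun i => funext fun k => ?_, fun i hi => funext fun k => ?_⟩
  · rw [hv]
    simp
  · rw [hv]
    refine Finset.sum_eq_zero fun i' _ => if_neg ?_
    rintro rfl
    exact hi i'.2

open Classical in
/-- The projection onto the vectors supported outside of `J`. -/
def offProj (n : ℕ) (J : Finset I) : L2Pow I n →L[ℂ] L2Pow I n :=
  scalarDiag n (fun i => if i ∈ J then 0 else 1) 1 fun i => by split_ifs <;> simp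

open Classical in
theorem fiber_offProj (J : Finset I) (v : L2Pow I n) (i : I) :
    fiber i (offProj n J v) = if i ∈ J then 0 else fiber i v := by
  rw [offProj, fiber_scalarDiag]
  split_ifs
  · rw [zero_smul]
  · rw [one_smul]

theorem mem_ker_offProj {J : Finset I} {v : L2Pow I n} :
    v ∈ LinearMap.ker (offProj n J : L2Pow I n →ₗ[ℂ] L2Pow I n) ↔ ∀ i ∉ J, fiber i v = 0 := by
  rw [LinearMap.mem_ker, ContinuousLinearMap.coe_coe]
  constructor
  · intro h i hi
    have := fiber_offProj J v i
    rwa [h, if_neg hi, map_zero, eq_comm] at this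
  · intro h
    refine ext_fiber fun i => ?_
    rw [fiber_offProj, map_zero]
    split_ifs with hi
    · rfl
    · exact h i hi

/-- The fibres over `J` of the vectors supported in `J`. -/
def fibers (J : Finset I) : L2Pow I n →ₗ[ℂ] (J → Fin n → ℂ) := LinearMap.pi fun i => fiber (i : I)

instance (J : Finset I) :
    FiniteDimensional ℂ (LinearMap.ker (offProj n J : L2Pow I n →ₗ[ℂ] L2Pow I n)) := by
  refine FiniteDimensional.of_injective ((fibers J).domRestrict _) fun v w h => Subtype.ext ?_
  refine ext_fiber fun i => ?_
  by_cases hi : i ∈ J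
  · exact congrFun h ⟨i, hi⟩
  · rw [mem_ker_offProj.1 v.2 i hi, mem_ker_offProj.1 w.2 i hi]

/-- The range of a field of idempotent matrices over a finite set `J`. -/
theorem finrank_range_inf_ker {p : L2Pow I n →ₗ[ℂ] L2Pow I n} {a : I → Matrix (Fin n) (Fin n) ℂ}
    (hp : ∀ v i, fiber i (p v) = a i *ᵥ fiber i v) (ha : ∀ i, a i * a i = a i) (J : Finset I) :
    Module.finrank ℂ (LinearMap.range p ⊓
      LinearMap.ker (offProj n J : L2Pow I n →ₗ[ℂ] L2Pow I n) : Submodule ℂ (L2Pow I n)) =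
      ∑ i ∈ J, (a i).rank := by
  -- Taking fibres over `J` identifies the intersection with the product of the ranges of the
  -- matrices `a i`, whose dimensions are the ranks.
  let f : (LinearMap.range p ⊓ LinearMap.ker (offProj n J : L2Pow I n →ₗ[ℂ] L2Pow I n) :
      Submodule ℂ (L2Pow I n)) →ₗ[ℂ] ∀ i : J, LinearMap.range (a i).mulVecLin :=
    LinearMap.pi fun i => ((fiber (i : I)).domRestrict _).codRestrict _ fun v => by
      obtain ⟨w, hw⟩ := v.2.1
      refine ⟨fiber (i : I) w, ?_⟩
      rw [LinearMap.domRestrict_apply, ← hw, hp, Matrix.mulVecLin_apply]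
  have hf : Function.Bijective f := by
    constructor
    · intro v w h
      refine Subtype.ext (ext_fiber fun i => ?_)
      by_cases hi : i ∈ J
      · exact congrArg Subtype.val (congrFun h ⟨i, hi⟩)
      · rw [mem_ker_offProj.1 v.2.2 i hi, mem_ker_offProj.1 w.2.2 i hi]
    · intro x
      obtain ⟨v, hv, hv'⟩ := exists_fiber_eq J fun i => (x i : Fin n → ℂ)
      have hpv : p v = v := by
        refine ext_fiber fun i => ?_
        rw [hp]
        by_cases hi : i ∈ J
        · rw [hv ⟨i, hi⟩]
          obtain ⟨y, hy⟩ := (x ⟨i, hi⟩).2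
          rw [← hy, Matrix.mulVecLin_apply, Matrix.mulVec_mulVec, ha]
        · rw [hv' i hi, Matrix.mulVec_zero]
      exact ⟨⟨v, ⟨v, hpv⟩, mem_ker_offProj.2 hv'⟩, funext fun i => Subtype.ext (hv i)⟩
  rw [(LinearEquiv.ofBijective f hf).finrank_eq, Module.finrank_pi_fintype,
    ← Finset.sum_coe_sort J fun i => (a i).rank]
  rfl

end MatrixFields

/-! ### The index of compressed diagonal operators -/

section CompressionIndex

variable {I A : Type*} [CStarAlgebra A] {n : ℕ}

theorem fiber_amplify (χ : I → A →⋆ₙₐ[ℂ] ℂ) (P : Matrix (Fin n) (Fin n) A) (v : L2Pow I n) (i : I) :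
    fiber i (amplify (diagRep χ) P v) = P.map (χ i) *ᵥ fiber i v := by
  ext j
  change ((∑ k, diagRep χ (P j k) (v k) : L2 I) : I → ℂ) i = _
  rw [lp.coeFn_sum, Finset.sum_apply]
  rfl

theorem norm_map_apply_le (χ : A →⋆ₙₐ[ℂ] ℂ) (P : Matrix (Fin n) (Fin n) A) (j k : Fin n) :
    ‖P.map χ j k‖ ≤ ∑ j, ∑ k, ‖P j k‖ :=
  (NonUnitalStarAlgHom.norm_apply_le χ (P j k)).trans <|
    (Finset.single_le_sum (f := fun k => ‖P j k‖) (fun _ _ => norm_nonneg _)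
      (Finset.mem_univ k)).trans
      (Finset.single_le_sum (f := fun j => ∑ k, ‖P j k‖)
        (fun _ _ => Finset.sum_nonneg fun _ _ => norm_nonneg _) (Finset.mem_univ j))

theorem map_mul_map {χ : A →⋆ₙₐ[ℂ] ℂ} {P : Matrix (Fin n) (Fin n) A} (hP : IsStarProjection P) :
    P.map χ * P.map χ = P.map χ := by
  conv_rhs => rw [← hP.isIdempotentElem.eq]
  ext j k
  simp [Matrix.mul_apply]

/-- The amplification of a direct sum of one-dimensional representations, as a bounded operator. -/
def amplifyCLM (χ : I → A →⋆ₙₐ[ℂ] ℂ) (P : Matrix (Fin n) (Fin n) A) : L2Pow I n →L[ℂ] L2Pow I n :=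
  matDiag (fun i => P.map (χ i)) (∑ j, ∑ k, ‖P j k‖) fun i => norm_map_apply_le (χ i) P

theorem fiber_amplifyCLM (χ : I → A →⋆ₙₐ[ℂ] ℂ) (P : Matrix (Fin n) (Fin n) A) (v : L2Pow I n)
    (i : I) : fiber i (amplifyCLM χ P v) = P.map (χ i) *ᵥ fiber i v := fiber_matDiag _ _ _ _ _

theorem amplifyCLM_apply (χ : I → A →⋆ₙₐ[ℂ] ℂ) (P : Matrix (Fin n) (Fin n) A) (v : L2Pow I n) :
    amplifyCLM χ P v = amplify (diagRep χ) P v :=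
  ext_fiber fun i => by rw [fiber_amplifyCLM, fiber_amplify]

theorem amplifyCLM_mul_self (χ : I → A →⋆ₙₐ[ℂ] ℂ) {P : Matrix (Fin n) (Fin n) A}
    (hP : IsStarProjection P) : amplifyCLM χ P * amplifyCLM χ P = amplifyCLM χ P := by
  refine ContinuousLinearMap.ext fun v => ext_fiber fun i => ?_
  rw [mul_apply_eq_comp, fiber_amplifyCLM, fiber_amplifyCLM, Matrix.mulVec_mulVec, map_mul_map hP]

theorem amplify_amplify (χ : I → A →⋆ₙₐ[ℂ] ℂ) {P : Matrix (Fin n) (Fin n) A}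
    (hP : IsStarProjection P) (v : L2Pow I n) :
    amplify (diagRep χ) P (amplify (diagRep χ) P v) = amplify (diagRep χ) P v :=
  ext_fiber fun i => by
    rw [fiber_amplify, fiber_amplify, Matrix.mulVec_mulVec, map_mul_map hP]

theorem offProj_mul_self (J : Finset I) : offProj n J * offProj n J = offProj n J := by
  classical
  refine ContinuousLinearMap.ext fun v => ext_fiber fun i => ?_
  rw [mul_apply_eq_comp, fiber_offProj, fiber_offProj]
  split_ifs <;> rfl

theorem offProj_mul_amplifyCLM (J : Finset I) (χ : I → A →⋆ₙₐ[ℂ] ℂ) (P : Matrix (Fin n) (Fin n) A) :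
    offProj n J * amplifyCLM χ P = amplifyCLM χ P * offProj n J := by
  classical
  refine ContinuousLinearMap.ext fun v => ext_fiber fun i => ?_
  rw [mul_apply_eq_comp, mul_apply_eq_comp, fiber_offProj, fiber_amplifyCLM,
    fiber_amplifyCLM, fiber_offProj]
  split_ifs
  · rw [Matrix.mulVec_zero]
  · rfl

theorem norm_offProj_mul_sub_le (J : Finset I) (χ ψ : I → A →⋆ₙₐ[ℂ] ℂ)
    (P : Matrix (Fin n) (Fin n) A) {ε : ℝ} (hε : 0 ≤ ε)
    (h : ∀ i ∉ J, ∀ j k, ‖ψ i (P j k) - χ i (P j k)‖ ≤ ε) :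
    ‖offProj n J * (amplifyCLM ψ P - amplifyCLM χ P)‖ ≤ n * n * ε := by
  classical
  have hb : ∀ i j k, ‖(if i ∈ J then 0 else P.map (ψ i) - P.map (χ i) :
      Matrix (Fin n) (Fin n) ℂ) j k‖ ≤ ε := fun i j k => by
    split_ifs with hi
    · simpa using hε
    · exact h i hi j k
  have : offProj n J * (amplifyCLM ψ P - amplifyCLM χ P) = matDiag _ ε hb := by
    refine ContinuousLinearMap.ext fun v => ext_fiber fun i => ?_
    rw [mul_apply_eq_comp, fiber_offProj, sub_apply, map_sub,
      fiber_amplifyCLM, fiber_amplifyCLM, fiber_matDiag]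
    split_ifs
    · rw [Matrix.zero_mulVec]
    · rw [Matrix.sub_mulVec]
  rw [this]
  refine (norm_matDiag_le _ _ _).trans_eq ?_
  rw [abs_of_nonneg hε]

/-- The inverse of the direct sum of `n` copies of a diagonal operator. -/
def copiesInv (n : ℕ) (w : I → ℝ) (hw : ∀ i, 1 ≤ w i) : L2Pow I n →L[ℂ] L2Pow I n :=
  scalarDiag n (fun i => ((w i)⁻¹ : ℝ)) 1 fun i => by
    rw [Complex.norm_real, Real.norm_of_nonneg (inv_nonneg.2 (zero_le_one.trans (hw i)))]
    exact inv_le_one_of_one_le₀ (hw i)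

theorem copiesInv_apply {w : I → ℝ} (hw : ∀ i, 1 ≤ w i) (v : L2Pow I n) (k : Fin n) :
    copiesInv n w hw v k = diagInv w hw (v k) := by
  ext i
  exact congrFun (fiber_scalarDiag _ _ _ v i) k

theorem fiber_copiesInv {w : I → ℝ} (hw : ∀ i, 1 ≤ w i) (v : L2Pow I n) (i : I) :
    fiber i (copiesInv n w hw v) = (((w i)⁻¹ : ℝ) : ℂ) • fiber i v := fiber_scalarDiag _ _ _ v i

theorem denseRange_copiesInv {w : I → ℝ} (hw : ∀ i, 1 ≤ w i) : DenseRange (copiesInv n w hw) := by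
  have h1 : DenseRange (diagInv w hw) := by
    refine (dense_diagPMap_domain hw).mono fun v hv => ⟨diagPMap w ⟨v, hv⟩, ?_⟩
    exact diagInv_diagPMap hw ⟨v, hv⟩
  have h2 : DenseRange (Pi.map fun _ : Fin n => diagInv w hw) := DenseRange.piMap fun _ => h1
  have h3 : DenseRange (WithLp.toLp 2 : (Fin n → L2 I) → L2Pow I n) :=
    (WithLp.toLp_surjective 2).denseRange
  have h4 := h3.comp h2 (PiLp.continuous_toLp 2 _)
  refine h4.mono ?_
  rintro _ ⟨v, rfl⟩
  refine ⟨WithLp.toLp 2 v, ?_⟩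
  ext1 k
  exact copiesInv_apply hw _ k

theorem injective_copiesInv {w : I → ℝ} (hw : ∀ i, 1 ≤ w i) :
    Function.Injective (copiesInv n w hw) := fun u v h => by
  refine ext_fiber fun i => ?_
  have h1 := congrArg (fiber i) h
  have h2 : (((w i)⁻¹ : ℝ) : ℂ) ≠ 0 := by
    exact_mod_cast (inv_pos.2 (zero_lt_one.trans_le (hw i))).ne'
  rw [fiber_copiesInv, fiber_copiesInv] at h1
  exact smul_right_injective _ h2 h1

open Classical in
/-- The restriction of a diagonal operator to the vectors supported in `J`. -/
def copiesOn (n : ℕ) (w : I → ℝ) (hw : ∀ i, 1 ≤ w i) (J : Finset I) : L2Pow I n →L[ℂ] L2Pow I n :=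
  scalarDiag n (fun i => if i ∈ J then (w i : ℂ) else 0) (∑ i ∈ J, w i) fun i => by
    have h0 : ∀ i, 0 ≤ w i := fun i => zero_le_one.trans (hw i)
    split_ifs with hi
    · rw [Complex.norm_real, Real.norm_of_nonneg (h0 i)]
      exact Finset.single_le_sum (fun i _ => h0 i) hi
    · simpa using Finset.sum_nonneg fun i _ => h0 i

open Classical in
theorem fiber_copiesOn {w : I → ℝ} (hw : ∀ i, 1 ≤ w i) (J : Finset I) (v : L2Pow I n) (i : I) :
    fiber i (copiesOn n w hw J v) = (if i ∈ J then (w i : ℂ) else 0) • fiber i v :=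
  fiber_scalarDiag _ _ _ v i

/-- This expresses the compression as `q K⁻¹ p` with the bounded operator `K = D⁻¹`, the form
required by `fredholm_compression`. -/
theorem mem_graph_compression {χ ψ : I → A →⋆ₙₐ[ℂ] ℂ} {w : I → ℝ} (hw : ∀ i, 1 ≤ w i)
    {P : Matrix (Fin n) (Fin n) A} (hP : IsStarProjection P)
    (v : LinearMap.range (amplify (diagRep χ) P)) (u : LinearMap.range (amplify (diagRep ψ) P)) :
    (v, u) ∈ (compression (diagRep ψ) (diagRep χ) (diagPMap w) P).graph ↔
      ∃ x, copiesInv n w hw x = v ∧ amplify (diagRep ψ) P x = u := by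
  have hv : amplify (diagRep χ) P v = v := by
    obtain ⟨_, v, rfl⟩ := v
    exact amplify_amplify χ hP v
  rw [LinearPMap.mem_graph_iff]
  constructor
  · rintro ⟨⟨v', hv'⟩, h1, h2⟩
    obtain rfl : v' = v := h1
    refine ⟨copies (diagPMap w) n ⟨_, hv'⟩, ?_, congrArg Subtype.val h2⟩
    refine Eq.trans ?_ hv
    ext1 k
    rw [copiesInv_apply]
    exact diagInv_diagPMap hw ⟨_, hv' k⟩
  · rintro ⟨x, h1, h2⟩
    have hd : ∀ k, amplify (diagRep χ) P v k ∈ (diagPMap w).domain := fun k => by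
      rw [hv, ← h1, copiesInv_apply]
      exact diagInv_mem_domain hw _
    refine ⟨⟨v, hd⟩, rfl, Subtype.ext ?_⟩
    refine Eq.trans ?_ h2
    refine congrArg (amplify (diagRep ψ) P) ?_
    change copies (diagPMap w) n ⟨amplify (diagRep χ) P v, hd⟩ = x
    ext1 k
    change diagPMap w ⟨amplify (diagRep χ) P v k, hd k⟩ = x k
    have h3 : amplify (diagRep χ) P v k = diagInv w hw (x k) := by rw [hv, ← h1, copiesInv_apply]
    simp only [h3]
    exact diagPMap_diagInv hw _ _

/-- The index formula for the compression of a diagonal operator. -/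
theorem index_compression {χ ψ : I → A →⋆ₙₐ[ℂ] ℂ} {w : I → ℝ} (hw : ∀ i, 1 ≤ w i)
    {P : Matrix (Fin n) (Fin n) A} (hP : IsStarProjection P) :
    ∃ ε : ℝ, 0 < ε ∧ ∀ J : Finset I, (∀ i ∉ J, ∀ j k, ‖ψ i (P j k) - χ i (P j k)‖ ≤ ε) →
      IsFredholmPMap (compression (diagRep ψ) (diagRep χ) (diagPMap w) P) ∧
      fredholmIndex (compression (diagRep ψ) (diagRep χ) (diagPMap w) P) =
        ∑ i ∈ J, (((P.map (χ i)).rank : ℤ) - (P.map (ψ i)).rank) := by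
  classical
  set p := amplifyCLM χ P with hp
  set q := amplifyCLM ψ P with hq
  set B := ‖2 * q - 1‖ with hB
  have hpos : 0 < B * (n * n) + 1 := by positivity
  -- This `ε` gives `‖(2 q - 1) e (q - p)‖ ≤ B n² ε < 1`, so the Neumann series inverts the element
  -- required by `exists_partial_inverse`. The summand `1` gives strictness and covers `B n² = 0`.
  refine ⟨(B * (n * n) + 1)⁻¹, inv_pos.2 hpos, fun J hJ => ?_⟩
  set e := offProj n J with he
  have hlt : ‖(2 * q - 1) * (e * (q - p))‖ < 1 := by
    refine (norm_mul_le _ _).trans_lt ?_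
    have := norm_offProj_mul_sub_le J χ ψ P (inv_pos.2 hpos).le hJ
    refine (mul_le_mul_of_nonneg_left this (norm_nonneg _)).trans_lt ?_
    rw [← hB, ← mul_assoc, ← div_eq_mul_inv, div_lt_one hpos]
    linarith
  obtain ⟨g, h1, h2, h3, h4, h5⟩ := exists_partial_inverse (amplifyCLM_mul_self χ hP)
    (amplifyCLM_mul_self ψ hP) (offProj_mul_self J) (offProj_mul_amplifyCLM J χ P)
    (offProj_mul_amplifyCLM J ψ P) (isUnit_one_sub_of_norm_lt_one hlt)
  have hpp : ∀ v, amplify (diagRep χ) P v = p v := fun v => (amplifyCLM_apply χ P v).symm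
  have hqq : ∀ v, amplify (diagRep ψ) P v = q v := fun v => (amplifyCLM_apply ψ P v).symm
  have hw0 : ∀ i, (w i : ℂ) ≠ 0 := fun i => by exact_mod_cast (zero_lt_one.trans_le (hw i)).ne'
  have key := fredholm_compression (p := amplify (diagRep χ) P) (q := amplify (diagRep ψ) P)
    (K := copiesInv n w hw) (D := copiesOn n w hw J) (e := e) (G := g)
    (p.continuous.congr fun v => (hpp v).symm) (q.continuous.congr fun v => (hqq v).symm)
    (amplify_amplify χ hP) (amplify_amplify ψ hP)
    (fun v => DFunLike.congr_fun (offProj_mul_self J) v)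
    (fun v => by
      rw [hqq, hqq]; exact (DFunLike.congr_fun (offProj_mul_amplifyCLM J ψ P) v).symm)
    (injective_copiesInv hw) (denseRange_copiesInv hw)
    (fun v => ext_fiber fun i => by
      rw [fiber_copiesInv, fiber_amplify, fiber_amplify, fiber_copiesInv, Matrix.mulVec_smul])
    (fun v => ext_fiber fun i => by
      rw [fiber_copiesInv, fiber_offProj, fiber_offProj, fiber_copiesInv]
      split_ifs
      · rw [smul_zero]
      · rfl)
    (fun v => ext_fiber fun i => by
      rw [fiber_copiesInv, fiber_copiesOn, map_sub, fiber_offProj, smul_smul]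
      split_ifs
      · rw [Complex.ofReal_inv, inv_mul_cancel₀ (hw0 i), one_smul, sub_zero]
      · rw [mul_zero, zero_smul, sub_self])
    (fun v => ext_fiber fun i => by
      rw [fiber_copiesOn, fiber_copiesInv, map_sub, fiber_offProj, smul_smul]
      split_ifs
      · rw [Complex.ofReal_inv, mul_inv_cancel₀ (hw0 i), one_smul, sub_zero]
      · rw [zero_mul, zero_smul, sub_self])
    (fun v => by rw [hqq, hpp]; exact DFunLike.congr_fun h1 v)
    (fun v => by rw [hpp]; exact DFunLike.congr_fun h2 v)
    (fun v => by rw [hqq, hqq]; exact DFunLike.congr_fun h3 v)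
    (fun v => DFunLike.congr_fun h5 v)
    _ (mem_graph_compression hw hP)
  refine ⟨key.1, key.2.trans ?_⟩
  rw [finrank_range_inf_ker (fiber_amplify χ P) (fun i => map_mul_map hP),
    finrank_range_inf_ker (fiber_amplify ψ P) (fun i => map_mul_map hP), Finset.sum_sub_distrib]
  push_cast
  rfl

end CompressionIndex

/-! ### Commutators with direct sums of characters -/

section DiagRep

variable {I A : Type*} [CStarAlgebra A]

theorem diagRep_apply (χ : I → A →⋆ₙₐ[ℂ] ℂ) (a : A) :
    diagRep χ a =
      diagCLM (fun i => χ i a) ‖a‖ fun i => NonUnitalStarAlgHom.norm_apply_le (χ i) a := rfl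

theorem commutatorBoundedBy_diagRep {w : I → ℝ} (hw : ∀ i, 1 ≤ w i) {χ ψ : I → A →⋆ₙₐ[ℂ] ℂ} {a : A}
    {C : ℝ} (hC : ∀ i, ‖ψ i a - χ i a‖ * w i ≤ C) (hC0 : 0 ≤ C) :
    CommutatorBoundedBy (offDiag (diagPMap w)) (blockDiag (diagRep ψ a) (diagRep χ a)) C := by
  rw [diagRep_apply, diagRep_apply]
  exact commutatorBoundedBy_diag hw _ _ hC hC0

theorem blockDiag_diagRep_mem_domain {w : I → ℝ} (hw : ∀ i, 1 ≤ w i) (χ ψ : I → A →⋆ₙₐ[ℂ] ℂ) (a : A)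
    {v : HSum (L2 I) (L2 I)} (hv : v ∈ (offDiag (diagPMap w)).domain) :
    blockDiag (diagRep ψ a) (diagRep χ a) v ∈ (offDiag (diagPMap w)).domain := by
  rw [diagRep_apply, diagRep_apply]
  exact blockDiag_mem_domain hw _ _ hv

end DiagRep

/-! ### The spectral triple of `Φ` and its index homomorphism -/

section Triple

variable (S : Scale) (L : LengthValues) (Φ : C(Odometer S, ℤ) →+ ℤ)

/-- The labels `(y, j)` with `y < s m`. -/
def labelsBelow (m : ℕ) : Finset (Labels S Φ) := (Finset.range (S.s m)).sigma fun _ => Finset.univ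

variable {S Φ}

theorem mem_labelsBelow {m : ℕ} {i : Labels S Φ} : i ∈ labelsBelow S Φ m ↔ lev S i.1 ≤ m := by
  rw [labelsBelow, Finset.mem_sigma, lev_le_iff, Finset.mem_range]
  simp

theorem one_le_weight (y : ℕ) : 1 ≤ weight S L y := L.one_le _

/-- A bound on the weight bounds the level of `y`, hence `y` itself, and each `y` carries only the
finitely many labels `j ≤ |φ_(y)|`. -/
theorem tendsto_weight : Filter.Tendsto (fun i : Labels S Φ => weight S L i.1) Filter.cofinite
    Filter.atTop := by
  refine Filter.tendsto_atTop.2 fun C => ?_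
  obtain ⟨m, hm⟩ := (L.tendsto.eventually_ge_atTop C).exists
  refine (labelsBelow S Φ m).finite_toSet.subset fun i hi => ?_
  refine mem_labelsBelow.2 (le_of_not_ge fun h => hi ?_)
  exact hm.trans (L.mono h)

theorem commutatorBoundedBy_rapidDecay {f : C(Odometer S, ℂ)} (hf : f ∈ rapidDecay S L) :
    CommutatorBoundedBy (offDiag (opD S L Φ)) (blockDiag (repEv S Φ f) (repOdd S Φ f))
      (2 * rdNorm S L 1 f) := by
  have hle : ∀ y, ‖delta S y f - deltaGam S y f‖ * weight S L y ≤ 2 * rdNorm S L 1 f :=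
    norm_deltaGam_sub_mul_weight_le hf
  have h1 : ∀ i : Labels S Φ, ‖(if 0 < coeff S Φ i.1 then deltaGam S i.1 else delta S i.1) f -
      (if 0 < coeff S Φ i.1 then delta S i.1 else deltaGam S i.1) f‖ * weight S L i.1 ≤
        2 * rdNorm S L 1 f := fun i => by
    split_ifs
    · rw [norm_sub_rev]
      exact hle i.1
    · exact hle i.1
  -- Nonnegativity of the constant is read off from the estimate at `y = 0`.
  have h2 : 0 ≤ 2 * rdNorm S L 1 f :=
    (mul_nonneg (norm_nonneg _) (zero_le_one.trans (one_le_weight L 0))).trans (hle 0)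
  exact commutatorBoundedBy_diagRep (fun i : Labels S Φ => one_le_weight L i.1) h1 h2

theorem isEvenSpectralTriple :
    IsEvenSpectralTriple (rapidDecay S L) (repEv S Φ) (repOdd S Φ) (opD S L Φ) := by
  have hw : ∀ i : Labels S Φ, 1 ≤ weight S L i.1 := fun i => one_le_weight L i.1
  have hD : IsSelfAdjoint (opD S L Φ) := isSelfAdjoint_diagPMap hw
  exact
  { isStarSubalgebra := ⟨rapidSubalgebra S L, coe_rapidSubalgebra⟩
    dense := dense_rapidDecay
    closed := hD.isClosed
    denseDomain := hD.dense_domain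
    selfAdjoint := isSelfAdjoint_offDiag hD (diagPMap_surjective hw)
    mem_domain := fun _ _ _ hv => blockDiag_diagRep_mem_domain hw _ _ _ hv
    bounded_commutator := fun _ hf => ⟨_, commutatorBoundedBy_rapidDecay L hf⟩
    compact_resolvent := ⟨_, (isInvSqrtOneAddSq_diag _).offDiag hD,
      isCompactOperator_blockDiag (isCompactOperator_diagInvSqrt (tendsto_weight L))
        (isCompactOperator_diagInvSqrt (tendsto_weight L))⟩ }

theorem rank_map_deltaGam {n : ℕ} (P : Matrix (Fin n) (Fin n) C(Odometer S, ℂ)) (y : ℕ) :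
    ((P.map (deltaGam S y)).rank : ℤ) =
      if y = 0 then 0 else ((evalMat P (gam S y : Odometer S)).rank : ℤ) := by
  split_ifs with h
  · have : P.map (deltaGam S y) = 0 := by
      ext j k
      rw [deltaGam, if_pos h]
      rfl
    rw [this, Matrix.rank_zero, Nat.cast_zero]
  · rw [deltaGam, if_neg h]
    rfl

/-- The finitely many entries of `P` share a level of uniform continuity, and `y` and `γ(y)` agree
at every level below `n(y)`. -/
theorem exists_norm_delta_sub_lt {n : ℕ} (P : Matrix (Fin n) (Fin n) C(Odometer S, ℂ)) {ε : ℝ}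
    (hε : 0 < ε) : ∃ M, ∀ y, M < lev S y → ∀ j k,
      ‖delta S y (P j k) - deltaGam S y (P j k)‖ < ε := by
  choose M hM using fun j k => exists_dist_lt_of_apply_eq (P j k) hε
  refine ⟨Finset.univ.sup fun j => Finset.univ.sup (M j), fun y hy j k => ?_⟩
  have h0 : y ≠ 0 := by
    rintro rfl
    rw [Nat.le_zero.1 ((lev_le_iff S).2 (S.pos 0))] at hy
    exact Nat.not_lt_zero _ hy
  have hle : M j k ≤ Finset.univ.sup fun j => Finset.univ.sup (M j) :=
    (Finset.le_sup (Finset.mem_univ k)).trans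
      (Finset.le_sup (f := fun j => Finset.univ.sup (M j)) (Finset.mem_univ j))
  rw [deltaGam, if_neg h0, ← dist_eq_norm]
  exact hM j k _ hle _ _ (natCast_gam_apply S hy).symm

/-- The index formula gives a sum of differences of ranks over finitely many labels. The expansion
of `Φ` applied to the rank function gives the same sum, with the `|φ_(y)|` labels over each `y`
grouped together. -/
theorem isIndexHom_comp_rankHom :
    IsIndexHom (repEv S Φ) (repOdd S Φ) (opD S L Φ) (Φ.comp rankHom) := by
  intro P
  obtain ⟨ε, hε, h⟩ := index_compression
    (χ := fun i : Labels S Φ => if 0 < coeff S Φ i.1 then delta S i.1 else deltaGam S i.1)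
    (ψ := fun i : Labels S Φ => if 0 < coeff S Φ i.1 then deltaGam S i.1 else delta S i.1)
    (w := fun i => weight S L i.1) (fun i => one_le_weight L i.1) P.2.2
  obtain ⟨M, hM⟩ := exists_norm_delta_sub_lt P.2.1 hε
  obtain ⟨M', hM'⟩ := exists_eq_of_apply_eq (rankFn P)
  -- The level must exceed `M`, so that the two fields of projections are close off the chosen
  -- labels, and `M'`, so that the rank function is constant on the classes of that level.
  obtain ⟨h1, h2⟩ := h (labelsBelow S Φ (max M M')) fun i hi j k => by
    rw [mem_labelsBelow, not_le] at hi
    have := (hM i.1 ((le_max_left _ _).trans_lt hi) j k).le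
    split_ifs
    · rwa [norm_sub_rev]
    · exact this
  refine ⟨h1, Eq.trans ?_ h2.symm⟩
  have h3 : (Φ.comp rankHom) (K0.mk P) = Φ (rankFn P) :=
    congrArg Φ (FreeAbelianGroup.lift_apply_of rankFn P)
  rw [h3, hom_apply_eq_sum S Φ (hM' _ (le_max_right M M')), labelsBelow, Finset.sum_sigma]
  refine Finset.sum_congr rfl fun y _ => ?_
  have h4 : ((P.2.1.map (delta S y)).rank : ℤ) = rankFn P (y : Odometer S) := rfl
  have h5 : ((P.2.1.map (deltaGam S y)).rank : ℤ) =
      if y = 0 then 0 else rankFn P (gam S y : Odometer S) := rank_map_deltaGam P.2.1 y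
  rw [← h4, ← h5]
  -- For `φ_(y) ≤ 0` the roles of `y` and `γ(y)` are exchanged, and the resulting minus sign turns
  -- the multiplicity `|φ_(y)|` into `φ_(y)`. For `φ_(y) = 0` there are no labels.
  by_cases hc : 0 < coeff S Φ y
  · simp only [hc, if_true, Finset.sum_const, Finset.card_univ, Fintype.card_fin, nsmul_eq_mul,
      Int.natCast_natAbs, abs_of_pos hc]
    ring
  · simp only [hc, if_false, Finset.sum_const, Finset.card_univ, Fintype.card_fin, nsmul_eq_mul,
      Int.natCast_natAbs, abs_of_nonpos (not_lt.1 hc)]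
    ring

theorem existsUnique_isIndexHom :
    ∃! ind : K0 C(Odometer S, ℂ) →+ ℤ,
      IsIndexHom (repEv S Φ) (repOdd S Φ) (opD S L Φ) ind := by
  refine ⟨_, isIndexHom_comp_rankHom L, fun ind h => ?_⟩
  -- Homomorphisms on `K₀` are determined by their values on the generators `[P]`, and these values
  -- are prescribed to be the indices.
  refine QuotientAddGroup.addMonoidHom_ext _ (FreeAbelianGroup.lift_ext _ _ fun P => ?_)
  exact (h P).2.trans (isIndexHom_comp_rankHom L P).2.symm

end Triple

end OdometerNCG

end

open OdometerNCG in
theorem mainTheorem9 (S : Scale) (L : LengthValues) (Φ : C(Odometer S, ℤ) →+ ℤ) :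
    IsEvenSpectralTriple (rapidDecay S L) (repEv S Φ) (repOdd S Φ) (opD S L Φ) ∧
    (∀ f ∈ rapidDecay S L,
      CommutatorBoundedBy (offDiag (opD S L Φ)) (blockDiag (repEv S Φ f) (repOdd S Φ f))
        (2 * rdNorm S L 1 f)) ∧
    (∃! ind : K0 C(Odometer S, ℂ) →+ ℤ,
      IsIndexHom (repEv S Φ) (repOdd S Φ) (opD S L Φ) ind) ∧
    IsIndexHom (repEv S Φ) (repOdd S Φ) (opD S L Φ) (Φ.comp rankHom) :=
  ⟨isEvenSpectralTriple L, fun _ hf => commutatorBoundedBy_rapidDecay L hf,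
    existsUnique_isIndexHom L, isIndexHom_comp_rankHom L⟩
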